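/- Let $t_1,\dots,t_n\in\mathbb{C}$ be pairwise distinct and let $Q_1,\dots,Q_n$ be complex $k\times k$ matrices with $\sum_{j=1}^n Q_j=0$. For a path-connected space $X$ and $x_0\in X$, let $\operatorname{cov}(X;x_0)$ denote the universal covering space: the set of pairs $(x,\alpha)$, where $x\in X$ and $\alpha$ is a homotopy class of paths in $X$ from $x_0$ to $x$. Write $\beta\cdot\alpha$ for the path going first along $\alpha$ and then along $\beta$. Let $Y$ be the solution of the Fuchsian system $$\frac{dY}{dx}=\Big(\sum_{j=1}^n\frac{Q_j}{x-t_j}\Big)Y,\qquad Y|_{x=\infty}=I,$$ holomorphic on $\operatorname{cov}(\mathbb{CP}^1\setminus\{t_1,\dots,t_n\};\infty)$, where the initial condition is imposed at the point given by the constant path at $\infty$. Let $1\le j\le n$, let $\mathcal V_j\subset\mathbb{C}$ be an open simply connected neighborhood of $t_j$ such that $t_i\notin\mathcal V_j$ for $i\ne j$, let $p_j\in\mathcal V_j\setminus\{t_j\}$, and let $\alpha_j$ be a path in $\mathbb{CP}^1\setminus\{t_1,\dots,t_n\}$ from $\infty$ to $p_j$. Let $Y_{\alpha_j}$ be the corresponding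 branch of $Y$ in $\mathcal V_j\setminus\{t_j\}$, that is, the function on $\operatorname{cov}(\mathcal V_j\setminus\{t_j\};p_j)$ given by $Y_{\alpha_j}(x,\beta)=Y(x,\beta\cdot\alpha_j)$. Then there exist a $k\times k$ matrix function $H_{\alpha_j}$, holomorphic and invertible at every point of the whole (non-punctured) neighborhood $\mathcal V_j$, and a $k\times k$ matrix function $P_{\alpha_j}$, holomorphic and invertible on the universal covering surface $\operatorname{cov}(\mathbb{C}\setminus\{t_j\};p_j)$, such that $$Y_{\alpha_j}(x,\beta)=H_{\alpha_j}(x)\,P_{\alpha_j}(x,\beta)\qquad\text{for all }(x,\beta)\in\operatorname{cov}(\mathcal V_j\setminus\{t_j\};p_j),$$ where on the right-hand side $\beta$ is regarded as a path in $\mathbb{C}\setminus\{t_j\}$. -/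

import Mathlib

/-- The universal covering space of `X` with distinguished point `x₀`: pairs of a point `x` and a
homotopy class of paths in `X` from `x₀` to `x`. -/
def UnivCover {X : Type*} [TopologicalSpace X] (x₀ : X) : Type _ :=
  Σ x : X, Path.Homotopic.Quotient x₀ x

namespace UnivCover

/-- The map of universal covering spaces induced by a continuous map. -/
def map {X Y : Type*} [TopologicalSpace X] [TopologicalSpace Y] {x₀ : X} (f : C(X, Y))
    (ξ : UnivCover x₀) : UnivCover (f x₀) :=
  ⟨f ξ.1, ξ.2.map f⟩

/-- Change of the distinguished point along a path `α` from `x₀` to `p`: the point `(x, β)` goes to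
`(x, γ)`, where `γ` goes first along `α`, then along `β`. -/
noncomputable def precomp {X : Type*} [TopologicalSpace X] {x₀ p : X} (α : Path x₀ p) (ξ : UnivCover p) :
    UnivCover x₀ :=
  ⟨ξ.1, (Path.Homotopic.Quotient.mk α).trans ξ.2⟩

/-- Let `f` be a function on the universal covering space of a subset `U` of a space `S`, and let
`ξ = (x, α)` be a point of that space. `IsSheet f ξ W g` says that `W ⊆ U` is an open neighborhood
of `x` and that on the sheet over `W` through `ξ` the function `f` is given by the function `g` of
the base point: if `β` is a path inside `W` from `x` to `y`, then the value of `f` at `y` and the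
class of `α` followed by `β` is `g y`. -/
def IsSheet {S E : Type*} [TopologicalSpace S] {U : Set S} {x₀ : U} (f : UnivCover x₀ → E)
    (ξ : UnivCover x₀) (W : Set S) (g : S → E) : Prop :=
  IsOpen W ∧ (ξ.1 : S) ∈ W ∧ W ⊆ U ∧
    ∀ (y : U) (β : Path ξ.1 y), (∀ s, (β s : S) ∈ W) →
      f ⟨y, ξ.2.trans (Path.Homotopic.Quotient.mk β)⟩ = g y

/-- A matrix function on the universal covering surface of a subset of the plane is holomorphic if,
around each point, it is given on a sheet by a matrix function with holomorphic entries. -/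
def IsHolomorphic {k : ℕ} {U : Set ℂ} {x₀ : U}
    (f : UnivCover x₀ → Matrix (Fin k) (Fin k) ℂ) : Prop :=
  ∀ ξ, ∃ (W : Set ℂ) (g : ℂ → Matrix (Fin k) (Fin k) ℂ), IsSheet f ξ W g ∧
    ∀ a b, DifferentiableOn ℂ (fun x => g x a b) W

end UnivCover

/-- The local coordinate of the Riemann sphere at infinity, as a parametrization: it sends `w` to
`1 / w`, and `0` to infinity. -/
noncomputable def coordInfty (w : ℂ) : OnePoint ℂ :=
  if w = 0 then OnePoint.infty else ((w⁻¹ : ℂ) : OnePoint ℂ)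

/-- Holomorphy of a matrix function (entrywise) on an open subset `W` of the Riemann sphere. -/
def SphereHolomorphicOn {k : ℕ} (g : OnePoint ℂ → Matrix (Fin k) (Fin k) ℂ)
    (W : Set (OnePoint ℂ)) : Prop :=
  (∀ z : ℂ, (z : OnePoint ℂ) ∈ W →
    ∀ a b, DifferentiableAt ℂ (fun w : ℂ => g (w : OnePoint ℂ) a b) z) ∧
  (OnePoint.infty ∈ W → ∀ a b, DifferentiableAt ℂ (fun w : ℂ => g (coordInfty w) a b) 0)

/-- The Riemann sphere without the finite points `t j`. -/
def puncturedSphere {n : ℕ} (t : Fin n → ℂ) : Set (OnePoint ℂ) :=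
  {x | ∀ j, x ≠ (t j : OnePoint ℂ)}

/-- Infinity, as the distinguished point of the punctured sphere. -/
def inftyPoint {n : ℕ} (t : Fin n → ℂ) : puncturedSphere t :=
  ⟨OnePoint.infty, fun j => OnePoint.infty_ne_coe (t j)⟩

/-- The coefficient `∑ j, Q j / (x - t j)` of the Fuchsian system. -/
noncomputable def fuchsianCoeff {k n : ℕ} (t : Fin n → ℂ) (Q : Fin n → Matrix (Fin k) (Fin k) ℂ)
    (x : ℂ) : Matrix (Fin k) (Fin k) ℂ :=
  ∑ j, (x - t j)⁻¹ • Q j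

/-- `Y` is the normalized solution of the Fuchsian system `dY/dx = (∑ j, Q j / (x - t j)) Y`: a
holomorphic matrix function on the universal covering surface of the punctured sphere with
distinguished point infinity, which satisfies the system and equals the identity at infinity (that
is, at the point given by the constant path). -/
structure IsNormalizedSolution {k n : ℕ} (t : Fin n → ℂ) (Q : Fin n → Matrix (Fin k) (Fin k) ℂ)
    (Y : UnivCover (inftyPoint t) → Matrix (Fin k) (Fin k) ℂ) : Prop where
  solves : ∀ ξ, ∃ (W : Set (OnePoint ℂ)) (g : OnePoint ℂ → Matrix (Fin k) (Fin k) ℂ),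
    UnivCover.IsSheet Y ξ W g ∧ SphereHolomorphicOn g W ∧
      ∀ z : ℂ, (z : OnePoint ℂ) ∈ W → ∀ a b,
        HasDerivAt (fun w : ℂ => g (w : OnePoint ℂ) a b)
          ((fuchsianCoeff t Q z * g (z : OnePoint ℂ)) a b) z
  normalized : Y ⟨inftyPoint t, Path.Homotopic.Quotient.refl (inftyPoint t)⟩ = 1

/-- The inclusion into the punctured sphere of a punctured neighborhood of `t j` which contains no
other `t i`. -/
def inclSphere {n : ℕ} (t : Fin n → ℂ) (j : Fin n) (V : Set ℂ) (hV : ∀ i, i ≠ j → t i ∉ V) :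
    C((V \ {t j} : Set ℂ), puncturedSphere t) where
  toFun x := ⟨((x : ℂ) : OnePoint ℂ), fun i hi => by
    have h : (x : ℂ) = t i := OnePoint.coe_injective hi
    by_cases hij : i = j
    · exact x.2.2 (by rw [h, hij]; rfl)
    · exact hV i hij (h ▸ x.2.1)⟩
  continuous_toFun := (OnePoint.continuous_coe.comp continuous_subtype_val).subtype_mk _

/-- The inclusion of a punctured set `V \ {c}` into the punctured plane. -/
def inclPlane (V : Set ℂ) (c : ℂ) : C((V \ {c} : Set ℂ), ({c}ᶜ : Set ℂ)) where
  toFun x := ⟨x, x.2.2⟩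
  continuous_toFun := continuous_subtype_val.subtype_mk _

/-- The branch of `Y` in the punctured neighborhood `V \ {t j}`, corresponding to the path `α` from
infinity to `p`: the value at `(x, β)` is that of `Y` at `x` and the class of `α` followed
by `β`. -/
noncomputable def branch {k n : ℕ} {t : Fin n → ℂ} {j : Fin n} {V : Set ℂ}
    (Y : UnivCover (inftyPoint t) → Matrix (Fin k) (Fin k) ℂ)
    (hV : ∀ i, i ≠ j → t i ∉ V) {p : (V \ {t j} : Set ℂ)}
    (α : Path (inftyPoint t) (inclSphere t j V hV p)) (ξ : UnivCover p) :
    Matrix (Fin k) (Fin k) ℂ :=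
  Y (UnivCover.precomp α (UnivCover.map (inclSphere t j V hV) ξ))

/-! On `V` the coefficient is `A = q / (x - t j) + f` with `q = Q j` and `f` holomorphic. Suppose
`f` can be traded for an entire `b`: there is an invertible holomorphic `H` on `V` with `H' = A H -
H B`, where `B = q / (x - t j) + b`. If `P` solves `P' = B P` on the universal cover of the
punctured plane, then `H P` solves the original system. With `P = H⁻¹ Y` at the base point, `H P`
and the branch of `Y` agree there, hence everywhere by continuation along paths.

The gauge `H` is the core (`exists_gauge_to_entire`). Take for `b` a Taylor polynomial of `f`, so
that `A - B` vanishes to high order at `t j`, and look for `H = 1 + z ^ N • G`. The equation for `G`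
has a singularity of the first kind with residue `X ↦ q X - X q`; choosing `N > 2 ‖q‖` excludes
resonance, and a power series solves it on the whole disc where its coefficients are holomorphic
(`exists_solution_regular_singular`). To get all of `V` from one series, `V` is first mapped onto a
disc or the plane by the Riemann mapping theorem (`exists_biholomorphic_eball`). Since `H = 1` at `t
j`, uniqueness for linear systems makes `H` invertible on `V` (`isUnit_of_gauge`).

The substitution `x = t j + exp s` turns `P' = B P` into a system with entire coefficients
(`exists_solution_puncturedPlane`). Invertibility of `P` needs that of `Y`, which spreads from the
base point because `∑ j, Q j = 0` makes infinity a regular point (`IsNormalizedSolution.isUnit`). -/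

/-! ### The Riemann mapping theorem -/

-- Montel's theorem. Compactness of the closed disc gives pointwise limits along an ultrafilter
-- without a diagonal argument, and the Schwarz lemma gives a Lipschitz constant `2 / r` common to
-- all members, which makes the convergence locally uniform.
open Filter Topology Metric Set in
theorem exists_tendstoLocallyUniformlyOn_ultrafilter {ι : Type*} (l : Ultrafilter ι) {U : Set ℂ}
    (hU : IsOpen U) {F : ι → ℂ → ℂ} (hd : ∀ n, DifferentiableOn ℂ (F n) U)
    (hb : ∀ n, MapsTo (F n) U (closedBall 0 1)) :
    ∃ f : ℂ → ℂ, TendstoLocallyUniformlyOn F f l U := by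
  have hpt : ∀ z ∈ U, ∃ w, Tendsto (fun n => F n z) l (𝓝 w) := by
    intro z hz
    obtain ⟨w, -, hw⟩ := (isCompact_closedBall (0 : ℂ) 1).ultrafilter_le_nhds
      (l.map fun n => F n z) (by
        rw [le_principal_iff]
        exact mem_map.2 (univ_mem' fun n => hb n hz))
    exact ⟨w, hw⟩
  choose! f hf using hpt
  refine ⟨f, Metric.tendstoLocallyUniformlyOn_iff.2 fun ε hε z hz => ?_⟩
  obtain ⟨r, hr, hrU⟩ := Metric.isOpen_iff.1 hU z hz
  have hlip : ∀ n, ∀ y ∈ ball z r, dist (F n y) (F n z) ≤ 2 / r * dist y z := by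
    intro n y hy
    refine Complex.dist_le_div_mul_dist_of_mapsTo_ball ((hd n).mono hrU) ?_ hy
    intro x hx
    have h1 := mem_closedBall.1 (hb n (hrU hx))
    have h2 := mem_closedBall'.1 (hb n hz)
    exact mem_closedBall.2 (by linarith [dist_triangle (F n x) 0 (F n z)])
  have hlipf : ∀ y ∈ ball z r, dist (f y) (f z) ≤ 2 / r * dist y z := fun y hy =>
    le_of_tendsto ((hf y (hrU hy)).dist (hf z hz)) (Eventually.of_forall fun n => hlip n y hy)
  have hε3 : 0 < ε / 3 := by positivity
  have hδ : 0 < min r (r / 2 * (ε / 3)) := by positivity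
  refine ⟨ball z (min r (r / 2 * (ε / 3))), mem_nhdsWithin_of_mem_nhds (ball_mem_nhds _ hδ), ?_⟩
  filter_upwards [(Metric.tendsto_nhds.1 (hf z hz)) (ε / 3) hε3] with n hn y hy
  have hy1 : y ∈ ball z r := ball_subset_ball (min_le_left _ _) hy
  have hy2 : dist y z < r / 2 * (ε / 3) := lt_of_lt_of_le hy (min_le_right _ _)
  have hy3 : 2 / r * dist y z < ε / 3 := by
    calc 2 / r * dist y z < 2 / r * (r / 2 * (ε / 3)) := by gcongr
      _ = ε / 3 := by field_simp
  have h1 := hlip n y hy1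
  have h2 := hlipf y hy1
  have h4 := dist_triangle4 (f y) (f z) (F n z) (F n y)
  rw [dist_comm (F n y) (F n z)] at h1
  rw [dist_comm (F n z) (f z)] at hn
  linarith

-- Hurwitz's theorem. Were `z₀` an isolated zero, `‖F n‖` would exceed half the minimum of `‖f‖` on
-- a small circle, and the maximum principle for `1 / F n` would carry this bound to `z₀`, where `F
-- n` is close to `0`.
open Filter Topology Metric Set in
theorem eventually_eq_zero_of_tendstoLocallyUniformlyOn {ι : Type*} {l : Filter ι} [l.NeBot]
    {U : Set ℂ} (hU : IsOpen U) {F : ι → ℂ → ℂ} {f : ℂ → ℂ}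
    (hf : TendstoLocallyUniformlyOn F f l U) (hd : ∀ n, DifferentiableOn ℂ (F n) U)
    (h0 : ∀ n, ∀ z ∈ U, F n z ≠ 0) {z₀ : ℂ} (hz₀ : z₀ ∈ U) (hfz : f z₀ = 0) :
    ∀ᶠ z in 𝓝 z₀, f z = 0 := by
  have hfd : DifferentiableOn ℂ f U := hf.differentiableOn (Eventually.of_forall hd) hU
  refine (hfd.analyticAt (hU.mem_nhds hz₀)).eventually_eq_zero_or_eventually_ne_zero.resolve_right
    fun hne => ?_
  have hne' := eventually_nhdsWithin_iff.1 hne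
  obtain ⟨r, hr, hrs⟩ := Metric.nhds_basis_closedBall.mem_iff.1
    (inter_mem hne' (hU.mem_nhds hz₀))
  have hrU : closedBall z₀ r ⊆ U := fun x hx => (hrs hx).2
  obtain ⟨x, hx, hxmin⟩ := (isCompact_sphere z₀ r).exists_isMinOn
    (NormedSpace.sphere_nonempty.2 hr.le)
    (hfd.continuousOn.norm.mono (sphere_subset_closedBall.trans hrU))
  have hm : 0 < ‖f x‖ := norm_pos_iff.2 ((hrs (sphere_subset_closedBall hx)).1
    (ne_of_mem_sphere hx hr.ne'))
  have hunif := (tendstoLocallyUniformlyOn_iff_forall_isCompact hU).1 hf _ hrU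
    (isCompact_closedBall z₀ r)
  obtain ⟨n, hn⟩ := ((Metric.tendstoUniformlyOn_iff.1 hunif) (‖f x‖ / 2) (half_pos hm)).exists
  have hzn := hn z₀ (mem_closedBall_self hr.le)
  have hmax : ‖(F n z₀)⁻¹‖ ≤ (‖f x‖ / 2)⁻¹ := by
    refine Complex.norm_le_of_forall_mem_frontier_norm_le (f := fun z => (F n z)⁻¹)
      (U := ball z₀ r) isBounded_ball ?_ ?_ (subset_closure (mem_ball_self hr))
    · refine DifferentiableOn.diffContOnCl ?_
      rw [closure_ball _ hr.ne']
      exact ((hd n).mono hrU).inv fun y hy => h0 n y (hrU hy)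
    · rw [frontier_ball _ hr.ne']
      intro y hy
      rw [norm_inv]
      have h1 := hn y (sphere_subset_closedBall hy)
      have h2 : ‖f x‖ ≤ ‖f y‖ := hxmin hy
      rw [dist_eq_norm] at h1
      have h3 := norm_sub_norm_le (f y) (F n y)
      gcongr
      linarith
  rw [norm_inv, inv_le_inv₀ (norm_pos_iff.2 (h0 n z₀ hz₀)) (half_pos hm)] at hmax
  rw [hfz, dist_zero_left] at hzn
  linarith

open Metric Set in
/-- Injective holomorphic maps of `U` to the unit disc which send `c` to `0`. -/
structure IsDiscEmbedding (U : Set ℂ) (c : ℂ) (f : ℂ → ℂ) : Prop where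
  mapsTo : MapsTo f U (ball 0 1)
  injOn : InjOn f U
  deriv_ne_zero : ∀ z ∈ U, deriv f z ≠ 0
  map_base : f c = 0

/-- `deriv` is `0` by default where the derivative does not exist, so `deriv_ne_zero` already
contains holomorphy. -/
theorem IsDiscEmbedding.differentiableOn {U : Set ℂ} {c : ℂ} {f : ℂ → ℂ}
    (h : IsDiscEmbedding U c f) : DifferentiableOn ℂ f U := fun z hz =>
  (differentiableAt_of_deriv_ne_zero (h.deriv_ne_zero z hz)).differentiableWithinAt

/-- The automorphism of the unit disc which sends `a` to `0`. -/
noncomputable def discShift (a z : ℂ) : ℂ := (z - a) / (1 - (starRingEnd ℂ) a * z)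

theorem discShift_denom_ne_zero {a z : ℂ} (ha : ‖a‖ < 1) (hz : ‖z‖ < 1) :
    1 - (starRingEnd ℂ) a * z ≠ 0 := by
  intro h
  have h1 : ‖(starRingEnd ℂ) a * z‖ < 1 := by
    rw [norm_mul, RCLike.norm_conj]
    nlinarith [norm_nonneg a, norm_nonneg z]
  rw [← sub_eq_zero.1 h] at h1
  simp at h1

theorem norm_discShift_lt_one {a z : ℂ} (ha : ‖a‖ < 1) (hz : ‖z‖ < 1) : ‖discShift a z‖ < 1 := by
  have hd := discShift_denom_ne_zero ha hz
  rw [discShift, norm_div, div_lt_one (norm_pos_iff.2 hd),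
    ← sq_lt_sq₀ (norm_nonneg _) (norm_nonneg _), ← Complex.normSq_eq_norm_sq,
    ← Complex.normSq_eq_norm_sq]
  have ha' : Complex.normSq a < 1 := by
    rw [Complex.normSq_eq_norm_sq]; nlinarith [norm_nonneg a]
  have hz' : Complex.normSq z < 1 := by
    rw [Complex.normSq_eq_norm_sq]; nlinarith [norm_nonneg z]
  simp only [Complex.normSq_apply, Complex.sub_re, Complex.sub_im, Complex.mul_re, Complex.mul_im,
    Complex.conj_re, Complex.conj_im, Complex.one_re, Complex.one_im] at *
  -- This is `|1 - conj a * z|² - |z - a|² = (1 - |a|²) (1 - |z|²) > 0`.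
  nlinarith [mul_pos (sub_pos.2 ha') (sub_pos.2 hz')]

theorem hasDerivAt_discShift {a z : ℂ} (ha : ‖a‖ < 1) (hz : ‖z‖ < 1) :
    HasDerivAt (discShift a)
      ((1 - (starRingEnd ℂ) a * a) / (1 - (starRingEnd ℂ) a * z) ^ 2) z := by
  have hd := discShift_denom_ne_zero ha hz
  have h := ((hasDerivAt_id z).sub_const a).div
    (((hasDerivAt_id z).const_mul ((starRingEnd ℂ) a)).const_sub 1) hd
  refine h.congr_deriv ?_
  simp only [id]
  ring

theorem discShift_injOn {a : ℂ} (ha : ‖a‖ < 1) : Set.InjOn (discShift a) (Metric.ball 0 1) := by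
  intro z hz w hw h
  rw [mem_ball_zero_iff] at hz hw
  have h1 := discShift_denom_ne_zero ha hz
  have h2 := discShift_denom_ne_zero ha hw
  have h3 := discShift_denom_ne_zero ha ha
  rw [discShift, discShift, div_eq_div_iff h1 h2] at h
  refine mul_right_cancel₀ h3 ?_
  linear_combination h

open Filter Topology Metric Set in
theorem exists_isDiscEmbedding_norm_deriv_maximal {U : Set ℂ} (hUo : IsOpen U)
    (hUc : IsPreconnected U) {c : ℂ} (hc : c ∈ U) (hne : ∃ f, IsDiscEmbedding U c f) :
    ∃ f, IsDiscEmbedding U c f ∧ ∀ h, IsDiscEmbedding U c h → ‖deriv h c‖ ≤ ‖deriv f c‖ := by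
  set S : Set ℝ := {x | ∃ f, IsDiscEmbedding U c f ∧ ‖deriv f c‖ = x} with hS
  obtain ⟨f₀, hf₀⟩ := hne
  have hSne : S.Nonempty := ⟨_, f₀, hf₀, rfl⟩
  have hSb : BddAbove S := by
    obtain ⟨r, hr, hrU⟩ := Metric.isOpen_iff.1 hUo c hc
    refine ⟨1 / r, ?_⟩
    rintro _ ⟨f, hf, rfl⟩
    refine Complex.norm_deriv_le_div_of_mapsTo_ball (hf.differentiableOn.mono hrU) ?_ hr
    rw [hf.map_base]
    exact fun x hx => ball_subset_closedBall (hf.mapsTo (hrU hx))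
  obtain ⟨u, -, hu, huS⟩ := exists_seq_tendsto_sSup hSne hSb
  choose F hF hFu using huS
  obtain ⟨f, hf⟩ := exists_tendstoLocallyUniformlyOn_ultrafilter (hyperfilter ℕ) hUo
    (fun n => (hF n).differentiableOn) (fun n x hx => ball_subset_closedBall ((hF n).mapsTo hx))
  have hd : ∀ᶠ n in (hyperfilter ℕ : Filter ℕ), DifferentiableOn ℂ (F n) U :=
    Eventually.of_forall fun n => (hF n).differentiableOn
  have hfd : DifferentiableOn ℂ f U := hf.differentiableOn hd hUo
  have hfderiv := hf.deriv hd hUo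
  have hfc : ‖deriv f c‖ = sSup S := by
    refine tendsto_nhds_unique ((hfderiv.tendsto_at hc).norm) ?_
    refine (hu.mono_left Nat.hyperfilter_le_atTop).congr fun n => (hFu n).symm
  have hmax : ∀ h, IsDiscEmbedding U c h → ‖deriv h c‖ ≤ ‖deriv f c‖ := fun h hh =>
    hfc ▸ le_csSup hSb ⟨h, hh, rfl⟩
  have hfc0 : deriv f c ≠ 0 := by
    intro h0
    have := hmax f₀ hf₀
    rw [h0, norm_zero] at this
    exact hf₀.deriv_ne_zero c hc (norm_le_zero_iff.1 this)
  -- Hurwitz for the derivatives: one zero would force `deriv f` to vanish on all of `U`, including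
  -- at `c`.
  have hf' : ∀ z ∈ U, deriv f z ≠ 0 := by
    intro z hz h0
    have h1 := eventually_eq_zero_of_tendstoLocallyUniformlyOn hUo hfderiv
      (fun n => ((hF n).differentiableOn).deriv hUo) (fun n => (hF n).deriv_ne_zero) hz h0
    exact hfc0 (((hfd.deriv hUo).analyticOnNhd hUo).eqOn_zero_of_preconnected_of_eventuallyEq_zero
      hUc hz h1 hc)
  refine ⟨f, ⟨?_, ?_, hf', ?_⟩, hmax⟩
  -- A limit has values in the closed disc only; since `f` is open, they lie in its interior.
  · intro z hz
    have hst : HasStrictDerivAt f (deriv f z) z :=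
      (hfd.analyticAt (hUo.mem_nhds hz)).hasStrictDerivAt
    have hle : ∀ y ∈ U, f y ∈ closedBall (0 : ℂ) 1 := fun y hy =>
      isClosed_closedBall.mem_of_tendsto (hf.tendsto_at hy)
        (Eventually.of_forall fun n => ball_subset_closedBall ((hF n).mapsTo hy))
    have : closedBall (0 : ℂ) 1 ∈ 𝓝 (f z) := by
      rw [← hst.map_nhds_eq (hf' z hz)]
      exact mem_map.2 (mem_of_superset (hUo.mem_nhds hz) hle)
    rw [← interior_closedBall (0 : ℂ) one_ne_zero]
    exact mem_interior_iff_mem_nhds.2 this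
  -- Hurwitz for `F n x - F n z` on `U \ {z}`: a second point with the same value would make `f`
  -- constant near `w`.
  · intro z hz w hw hzw
    by_contra hne
    have hU' : IsOpen (U \ {z}) := hUo.sdiff isClosed_singleton
    have hlim : TendstoLocallyUniformlyOn (fun n x => F n x - F n z) (fun x => f x - f z)
        (hyperfilter ℕ : Filter ℕ) (U \ {z}) := by
      have h1 := hf.mono (sdiff_subset (s := U) (t := {z}))
      have h2 : TendstoLocallyUniformlyOn (fun n (_ : ℂ) => F n z) (fun _ => f z)
          (hyperfilter ℕ : Filter ℕ) (U \ {z}) :=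
        ((hf.tendsto_at hz).tendstoUniformlyOn_const (U \ {z})).tendstoLocallyUniformlyOn
      exact h1.sub h2
    have h1 := eventually_eq_zero_of_tendstoLocallyUniformlyOn hU' hlim
      (fun n => (((hF n).differentiableOn).mono sdiff_subset).sub_const _)
      (fun n x hx => sub_ne_zero.2 fun h => hx.2 ((hF n).injOn hx.1 hz h))
      (z₀ := w) ⟨hw, fun h => hne h.symm⟩ (sub_eq_zero.2 hzw.symm)
    refine hf' w hw ?_
    have h2 : f =ᶠ[𝓝 w] fun _ => f z := h1.mono fun x hx => sub_eq_zero.1 hx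
    rw [h2.deriv_eq, deriv_const]
  · refine tendsto_nhds_unique (hf.tendsto_at hc) ?_
    simp [(hF _).map_base]

-- A continuous square root of a differentiable function is differentiable, since the slope of `g`
-- is the slope of `k` divided by `g x + g z`.
open Filter Topology in
theorem hasDerivAt_of_sq_eq {g k : ℂ → ℂ} {k' z : ℂ} (hg : ContinuousAt g z)
    (hgk : ∀ᶠ x in 𝓝 z, g x ^ 2 = k x) (hk : HasDerivAt k k' z) (h0 : g z ≠ 0) :
    HasDerivAt g (k' / (2 * g z)) z := by
  rw [hasDerivAt_iff_tendsto_slope] at hk ⊢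
  have hsum : Tendsto (fun x => g x + g z) (𝓝 z) (𝓝 (2 * g z)) := by
    rw [two_mul]
    exact hg.tendsto.add_const _
  have h2 : 2 * g z ≠ 0 := mul_ne_zero two_ne_zero h0
  refine (hk.div (hsum.mono_left nhdsWithin_le_nhds) h2).congr' ?_
  have hne := hsum.eventually_ne h2
  filter_upwards [nhdsWithin_le_nhds hgk, nhdsWithin_le_nhds hne] with x hx hx0
  simp only [Pi.div_apply, slope, vsub_eq_sub, smul_eq_mul]
  rw [div_eq_iff hx0, ← hx, ← hgk.self_of_nhds]
  ring

-- A square root `g` of `z - a` never takes both a value and its negative. Its image contains a disc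
-- about `g c`, so it avoids a disc about `-g c`, and inversion in that disc makes it bounded.
open Filter Topology Metric Set in
theorem exists_injOn_mapsTo_ball_deriv_ne_zero {U : Set ℂ} (hUo : IsOpen U)
    (hUc : IsSimplyConnected U) (hU : U ≠ univ) {c : ℂ} (hc : c ∈ U) :
    ∃ f : ℂ → ℂ, MapsTo f U (ball 0 1) ∧ InjOn f U ∧ ∀ z ∈ U, deriv f z ≠ 0 := by
  obtain ⟨a, ha⟩ := (ne_univ_iff_exists_notMem U).1 hU
  obtain ⟨g, hgc, hg⟩ := Complex.exists_continuousOn_pow_eq hUc hUo (g := fun z => z - a)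
    (by fun_prop) (by rintro ⟨z, hz, h⟩; exact ha (sub_eq_zero.1 h ▸ hz)) two_ne_zero
  have hg0 : ∀ z ∈ U, g z ≠ 0 := fun z hz h => ha <| by
    have := hg z
    rw [h, zero_pow two_ne_zero] at this
    exact sub_eq_zero.1 this.symm ▸ hz
  have hgD : ∀ z ∈ U, HasDerivAt g (1 / (2 * g z)) z := fun z hz =>
    hasDerivAt_of_sq_eq (hgc.continuousAt (hUo.mem_nhds hz)) (Eventually.of_forall hg)
      ((hasDerivAt_id z).sub_const a) (hg0 z hz)
  have hgd : DifferentiableOn ℂ g U := fun z hz => (hgD z hz).differentiableAt.differentiableWithinAt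
  have hg' : ∀ z ∈ U, 1 / (2 * g z) ≠ 0 := fun z hz =>
    one_div_ne_zero (mul_ne_zero two_ne_zero (hg0 z hz))
  have hst : HasStrictDerivAt g (1 / (2 * g c)) c := by
    rw [← (hgD c hc).deriv]
    exact (hgd.analyticAt (hUo.mem_nhds hc)).hasStrictDerivAt
  have himg : g '' U ∈ 𝓝 (g c) := by
    rw [← hst.map_nhds_eq (hg' c hc)]
    exact image_mem_map (hUo.mem_nhds hc)
  obtain ⟨ε, hε, hεU⟩ := Metric.mem_nhds_iff.1 himg
  have hfar : ∀ z ∈ U, ε ≤ ‖g z + g c‖ := by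
    intro z hz
    by_contra! hlt
    have hmem : -g z ∈ ball (g c) ε := by
      rwa [mem_ball, dist_eq_norm, ← neg_add', norm_neg]
    obtain ⟨x, hx, hxz⟩ := hεU hmem
    have h1 : x = z := by
      have h2 := hg x
      rw [hxz, neg_sq, hg z] at h2
      exact (sub_left_injective h2).symm
    rw [h1] at hxz
    exact hg0 z hz (self_eq_neg.1 hxz)
  have hne : ∀ z ∈ U, g z + g c ≠ 0 := fun z hz => norm_pos_iff.1 (hε.trans_le (hfar z hz))
  have hε0 : ((ε / 2 : ℝ) : ℂ) ≠ 0 := by exact_mod_cast (half_pos hε).ne'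
  refine ⟨fun z => ((ε / 2 : ℝ) : ℂ) / (g z + g c), ?_, ?_, ?_⟩
  · intro z hz
    have := hfar z hz
    rw [mem_ball_zero_iff, norm_div, Complex.norm_real, Real.norm_of_nonneg (half_pos hε).le,
      div_lt_one (hε.trans_le this)]
    linarith
  · intro z hz w hw h
    have h1 : g z = g w := by
      simp only [div_eq_div_iff (hne z hz) (hne w hw)] at h
      exact (add_right_cancel (mul_left_cancel₀ hε0 h)).symm
    have h2 := hg z
    rw [h1, hg w] at h2
    exact (sub_left_injective h2).symm
  · intro z hz
    rw [((hasDerivAt_const z ((ε / 2 : ℝ) : ℂ)).fun_div ((hgD z hz).add_const (g c))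
      (hne z hz)).deriv]
    have h1 := hg' z hz
    have h2 := hne z hz
    rw [zero_mul, zero_sub]
    exact div_ne_zero (neg_ne_zero.2 (mul_ne_zero hε0 h1)) (pow_ne_zero 2 h2)

-- Koebe's square-root trick: move the omitted value `w` to `0`, take a square root, and move its
-- value `b` at `c` back to `0`. With `b ^ 2 = -w` the derivative at `c` grows by the factor `(1 +
-- ‖b‖²) / (2 ‖b‖) > 1`.
open Filter Topology Metric Set in
theorem exists_isDiscEmbedding_lt_norm_deriv {U : Set ℂ} (hUo : IsOpen U)
    (hUc : IsSimplyConnected U) {c : ℂ} (hc : c ∈ U) {f : ℂ → ℂ} (hf : IsDiscEmbedding U c f)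
    {w : ℂ} (hw : ‖w‖ < 1) (hwf : w ∉ f '' U) :
    ∃ h, IsDiscEmbedding U c h ∧ ‖deriv f c‖ < ‖deriv h c‖ := by
  have hfn : ∀ z ∈ U, ‖f z‖ < 1 := fun z hz => mem_ball_zero_iff.1 (hf.mapsTo hz)
  have hfD : ∀ z ∈ U, HasDerivAt f (deriv f z) z := fun z hz =>
    (differentiableAt_of_deriv_ne_zero (hf.deriv_ne_zero z hz)).hasDerivAt
  set k : ℂ → ℂ := fun z => discShift w (f z) with hk
  have hkD : ∀ z ∈ U, HasDerivAt k
      ((1 - (starRingEnd ℂ) w * w) / (1 - (starRingEnd ℂ) w * f z) ^ 2 * deriv f z) z :=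
    fun z hz => (hasDerivAt_discShift hw (hfn z hz)).comp z (hfD z hz)
  have hk0 : ∀ z ∈ U, k z ≠ 0 := by
    intro z hz h
    rcases div_eq_zero_iff.1 h with h | h
    · exact hwf ⟨z, hz, sub_eq_zero.1 h⟩
    · exact discShift_denom_ne_zero hw (hfn z hz) h
  obtain ⟨g, hgc, hg⟩ := Complex.exists_continuousOn_pow_eq hUc hUo (g := k)
    (fun z hz => (hkD z hz).continuousAt.continuousWithinAt)
    (by rintro ⟨z, hz, h⟩; exact hk0 z hz h) two_ne_zero
  have hg0 : ∀ z ∈ U, g z ≠ 0 := fun z hz h => hk0 z hz (by rw [← hg, h]; simp)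
  have hgn : ∀ z ∈ U, ‖g z‖ < 1 := by
    intro z hz
    have := norm_discShift_lt_one hw (hfn z hz)
    rw [show discShift w (f z) = g z ^ 2 from (hg z).symm, norm_pow] at this
    nlinarith [norm_nonneg (g z)]
  have hgD : ∀ z ∈ U, HasDerivAt g ((1 - (starRingEnd ℂ) w * w) /
      (1 - (starRingEnd ℂ) w * f z) ^ 2 * deriv f z / (2 * g z)) z := by
    exact fun z hz => hasDerivAt_of_sq_eq (hgc.continuousAt (hUo.mem_nhds hz))
      (Eventually.of_forall hg) (hkD z hz) (hg0 z hz)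
  set b := g c with hb
  have hbn : ‖b‖ < 1 := hgn c hc
  have hw1 : 1 - (starRingEnd ℂ) w * w ≠ 0 := discShift_denom_ne_zero hw hw
  have hb1 : 1 - (starRingEnd ℂ) b * b ≠ 0 := discShift_denom_ne_zero hbn hbn
  have hhD : ∀ z ∈ U, HasDerivAt (fun z => discShift b (g z))
      ((1 - (starRingEnd ℂ) b * b) / (1 - (starRingEnd ℂ) b * g z) ^ 2 *
      ((1 - (starRingEnd ℂ) w * w) /
      (1 - (starRingEnd ℂ) w * f z) ^ 2 * deriv f z / (2 * g z))) z :=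
    fun z hz => (hasDerivAt_discShift hbn (hgn z hz)).comp z (hgD z hz)
  refine ⟨fun z => discShift b (g z), ⟨?_, ?_, ?_, ?_⟩, ?_⟩
  · exact fun z hz => mem_ball_zero_iff.2 (norm_discShift_lt_one hbn (hgn z hz))
  · intro x hx y hy hxy
    have h1 : g x = g y := discShift_injOn hbn (mem_ball_zero_iff.2 (hgn x hx))
      (mem_ball_zero_iff.2 (hgn y hy)) hxy
    have h2 : k x = k y := by rw [← hg, ← hg, h1]
    exact hf.injOn hx hy (discShift_injOn hw (hf.mapsTo hx) (hf.mapsTo hy) h2)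
  · intro z hz
    rw [(hhD z hz).deriv]
    have h1 := discShift_denom_ne_zero hbn (hgn z hz)
    have h2 := discShift_denom_ne_zero hw (hfn z hz)
    have h3 := hg0 z hz
    have h4 := hf.deriv_ne_zero z hz
    exact mul_ne_zero (div_ne_zero hb1 (pow_ne_zero 2 h1)) (div_ne_zero (mul_ne_zero
      (div_ne_zero hw1 (pow_ne_zero 2 h2)) h4) (mul_ne_zero two_ne_zero h3))
  · simp [discShift, hb]
  · rw [(hhD c hc).deriv, hf.map_base, ← hb]
    have hbw : b ^ 2 = -w := by rw [hb, hg, hk]; simp [discShift, hf.map_base]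
    have hbw' : ‖b‖ ^ 2 = ‖w‖ := by rw [← norm_pow, hbw, norm_neg]
    have hb0 : 0 < ‖b‖ := norm_pos_iff.2 (hg0 c hc)
    have e1 : ∀ v : ℂ, 1 - (starRingEnd ℂ) v * v = ((1 - ‖v‖ ^ 2 : ℝ) : ℂ) := by
      intro v; rw [mul_comm, Complex.mul_conj, Complex.normSq_eq_norm_sq]; push_cast; rfl
    have hpos : 0 < ‖deriv f c‖ := norm_pos_iff.2 (hf.deriv_ne_zero c hc)
    have hbp : 0 < 1 - ‖b‖ ^ 2 := by nlinarith
    have hwp : 0 < 1 - ‖w‖ ^ 2 := by nlinarith [norm_nonneg w]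
    rw [e1, e1]
    simp only [norm_mul, norm_div, norm_pow, Complex.norm_real, Real.norm_eq_abs, mul_zero,
      sub_zero, norm_one, abs_of_pos hbp, abs_of_pos hwp, Complex.norm_ofNat]
    rw [← hbw', show (1 - ‖b‖ ^ 2) / (1 - ‖b‖ ^ 2) ^ 2 *
      ((1 - (‖b‖ ^ 2) ^ 2) / 1 ^ 2 * ‖deriv f c‖ / (2 * ‖b‖)) =
      ‖deriv f c‖ * ((1 + ‖b‖ ^ 2) / (2 * ‖b‖)) by field_simp; ring]
    refine lt_mul_of_one_lt_right hpos ((one_lt_div (by positivity)).2 ?_)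
    nlinarith [sq_pos_of_pos (sub_pos.2 hbn)]

open Filter Topology Metric Set in
/-- The **Riemann mapping theorem**, together with the trivial case of the whole plane. -/
theorem exists_biholomorphic_eball {U : Set ℂ} (hUo : IsOpen U) (hUc : IsSimplyConnected U) {c : ℂ}
    (hc : c ∈ U) : ∃ (R : ENNReal) (φ ψ : ℂ → ℂ), 0 < R ∧ φ c = 0 ∧
      DifferentiableOn ℂ φ U ∧ MapsTo φ U (eball 0 R) ∧
      DifferentiableOn ℂ ψ (eball 0 R) ∧ MapsTo ψ (eball 0 R) U ∧
      LeftInvOn ψ φ U ∧ LeftInvOn φ ψ (eball 0 R) := by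
  -- An extended radius treats both cases alike: `R = ⊤` for the plane, `R = 1` otherwise.
  by_cases hU : U = univ
  · subst hU
    refine ⟨⊤, fun z => z - c, fun z => z + c, by simp, by simp, by fun_prop, ?_, by fun_prop,
      fun _ _ => mem_univ _, fun z _ => by simp, fun z _ => by simp⟩
    intro z _
    simp
  · obtain ⟨f₁, hf₁, hf₁i, hf₁d⟩ :=
      exists_injOn_mapsTo_ball_deriv_ne_zero hUo hUc hU hc
    have hfn : ∀ z ∈ U, ‖f₁ z‖ < 1 := fun z hz => mem_ball_zero_iff.1 (hf₁ hz)
    have hne : ∃ f, IsDiscEmbedding U c f := by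
      refine ⟨fun z => discShift (f₁ c) (f₁ z), ?_, ?_, ?_, by simp [discShift]⟩
      · exact fun z hz => mem_ball_zero_iff.2 (norm_discShift_lt_one (hfn c hc) (hfn z hz))
      · exact fun x hx y hy hxy => hf₁i hx hy (discShift_injOn (hfn c hc) (hf₁ hx) (hf₁ hy) hxy)
      · intro z hz
        have h := (hasDerivAt_discShift (hfn c hc) (hfn z hz)).comp z
          (differentiableAt_of_deriv_ne_zero (hf₁d z hz)).hasDerivAt
        rw [show (fun z => discShift (f₁ c) (f₁ z)) = discShift (f₁ c) ∘ f₁ from rfl, h.deriv]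
        have h1 := discShift_denom_ne_zero (hfn c hc) (hfn z hz)
        have h2 := discShift_denom_ne_zero (hfn c hc) (hfn c hc)
        have h3 := hf₁d z hz
        exact mul_ne_zero (div_ne_zero h2 (pow_ne_zero 2 h1)) h3
    obtain ⟨f, hf, hmax⟩ := exists_isDiscEmbedding_norm_deriv_maximal hUo
      hUc.isPathConnected.isConnected.isPreconnected hc hne
    have hsurj : SurjOn f U (ball 0 1) := by
      intro w hw
      by_contra hwf
      obtain ⟨h, hh, hlt⟩ := exists_isDiscEmbedding_lt_norm_deriv hUo hUc hc hf
        (mem_ball_zero_iff.1 hw) hwf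
      exact absurd (hmax h hh) (not_le.2 hlt)
    have hball : eball (0 : ℂ) 1 = ball 0 1 := by
      rw [← ENNReal.coe_one, Metric.eball_coe]; rfl
    have hmem : ∀ w ∈ ball (0 : ℂ) 1, Function.invFunOn f U w ∈ U := fun w hw =>
      Function.invFunOn_mem (hsurj hw)
    refine ⟨1, f, Function.invFunOn f U, zero_lt_one, hf.map_base, hf.differentiableOn, ?_, ?_, ?_,
      hf.injOn.leftInvOn_invFunOn, ?_⟩
    · rw [hball]; exact hf.mapsTo
    · rw [hball]
      intro w hw
      have hz := hmem w hw
      have hst : HasStrictDerivAt f (deriv f _) _ :=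
        (hf.differentiableOn.analyticAt (hUo.mem_nhds hz)).hasStrictDerivAt
      have := hst.to_local_left_inverse (hf.deriv_ne_zero _ hz) (g := Function.invFunOn f U)
        (mem_of_superset (hUo.mem_nhds hz) fun x hx => hf.injOn.leftInvOn_invFunOn hx)
      rw [Function.invFunOn_eq (hsurj hw)] at this
      exact this.hasDerivAt.differentiableAt.differentiableWithinAt
    · rw [hball]; exact hmem
    · rw [hball]; exact fun w hw => Function.invFunOn_eq (hsurj hw)
-- Power series solutions at a singularity of the first kind
theorem summable_norm_mul_pow {E : Type*} [SeminormedAddCommGroup E] {v : ℕ → E} {r ρ M : ℝ} (hρ : 0 < ρ) (hρr : ρ < r)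
    (hM : ∀ n, ‖v n‖ * r ^ n ≤ M) : Summable fun n => ‖v n‖ * ρ ^ n := by
  have hr : 0 < r := hρ.trans hρr
  refine Summable.of_nonneg_of_le (fun n => by positivity) (fun n => ?_)
    ((summable_geometric_of_lt_one (by positivity) ((div_lt_one hr).2 hρr)).mul_left M)
  calc ‖v n‖ * ρ ^ n = (‖v n‖ * r ^ n) * (ρ / r) ^ n := by rw [div_pow]; field_simp
    _ ≤ M * (ρ / r) ^ n := by gcongr; exact hM n

section FormalSolution

variable {E : Type*} [NormedAddCommGroup E] [NormedSpace ℂ E]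

theorem hasSum_sum_antidiagonal_apply [CompleteSpace E] {a : ℕ → E →L[ℂ] E} {b : ℕ → E}
    (ha : Summable fun n => ‖a n‖) (hb : Summable fun n => ‖b n‖) :
    HasSum (fun n => ∑ p ∈ Finset.HasAntidiagonal.antidiagonal n, a p.1 (b p.2)) ((∑' n, a n) (∑' n, b n)) := by
  have hs : Summable fun p : ℕ × ℕ => a p.1 (b p.2) := by
    refine Summable.of_norm_bounded (ha.mul_of_nonneg hb (fun _ => norm_nonneg _)
      fun _ => norm_nonneg _) fun p => (a p.1).le_opNorm _
  have hval : ∑' p : ℕ × ℕ, a p.1 (b p.2) = (∑' n, a n) (∑' n, b n) := by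
    rw [hs.tsum_prod]
    have h1 : ∀ i, ∑' j, a i (b j) = a i (∑' j, b j) := fun i =>
      ((a i).map_tsum hb.of_norm).symm
    simp_rw [h1]
    exact ((ContinuousLinearMap.apply ℂ E (∑' j, b j)).map_tsum ha.of_norm).symm
  have h2 : HasSum (fun p : ℕ × ℕ => a p.1 (b p.2)) ((∑' n, a n) (∑' n, b n)) :=
    hval ▸ hs.hasSum
  refine ((Finset.HasAntidiagonal.sigmaAntidiagonalEquivProd (A := ℕ)).hasSum_iff.2 h2).sigma
    fun n => ?_
  have h3 := (Finset.HasAntidiagonal.antidiagonal n).hasSum fun p : ℕ × ℕ => a p.1 (b p.2)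
  exact h3

/-- The sequence determined by `u m = T m (∑ i < m, a (m - i) (u i) + b m)`. -/
def triangularSolution (T : ℕ → E → E) (a : ℕ → E →L[ℂ] E) (b : ℕ → E) : ℕ → E
  | m => T m (∑ i : Fin m, a (m - i) (triangularSolution T a b i) + b m)
  decreasing_by exact i.2

/-- The recursion is solvable because `m + c - a 0` is invertible for every `m ≥ 0`, by the Neumann
series; this absence of resonance is what `‖a 0‖ < c` provides. -/
theorem exists_formal_solution [CompleteSpace E] {c : ℝ} (a : ℕ → E →L[ℂ] E) (b : ℕ → E)
    (hc : ‖a 0‖ < c) : ∃ u : ℕ → E, ∀ m : ℕ,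
      ((m + c : ℝ) : ℂ) • u m = ∑ p ∈ Finset.HasAntidiagonal.antidiagonal m, a p.1 (u p.2) + b m := by
  have hsolve : ∀ (m : ℕ) (y : E), ∃ x, ((m + c : ℝ) : ℂ) • x - a 0 x = y := by
    intro m y
    have hm : (0 : ℝ) < m + c := by
      linarith [norm_nonneg (a 0), (Nat.cast_nonneg m : (0 : ℝ) ≤ m)]
    have hlt : ‖((m + c : ℝ) : ℂ)⁻¹ • a 0‖ < 1 := by
      rw [norm_smul, norm_inv, Complex.norm_real, Real.norm_of_nonneg hm.le, inv_mul_lt_one₀ hm]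
      linarith [(Nat.cast_nonneg m : (0 : ℝ) ≤ m)]
    obtain ⟨v, hv⟩ := isUnit_one_sub_of_norm_lt_one hlt
    refine ⟨((m + c : ℝ) : ℂ)⁻¹ • (↑v⁻¹ : E →L[ℂ] E) y, ?_⟩
    have h1 : (1 - ((m + c : ℝ) : ℂ)⁻¹ • a 0) ((↑v⁻¹ : E →L[ℂ] E) y) = y := by
      rw [← hv, ← mul_apply_eq_comp, Units.mul_inv, one_apply_eq_self]
    have hm' : ((m + c : ℝ) : ℂ) ≠ 0 := by exact_mod_cast hm.ne'
    rw [smul_smul, mul_inv_cancel₀ hm', one_smul, map_smul]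
    simpa using h1
  choose T hT using hsolve
  refine ⟨triangularSolution T a b, fun m => ?_⟩
  have h1 := hT m (∑ i : Fin m, a (m - i) (triangularSolution T a b i) + b m)
  have h2 : T m (∑ i : Fin m, a (m - i) (triangularSolution T a b i) + b m) =
      triangularSolution T a b m := by rw [triangularSolution]
  rw [h2, sub_eq_iff_eq_add] at h1
  rw [h1, ← Finset.Nat.sum_antidiagonal_swap,
    Finset.Nat.sum_antidiagonal_eq_sum_range_succ_mk, Finset.sum_range_succ,
    Fin.sum_univ_eq_sum_range (fun k => a (m - k) (triangularSolution T a b k))]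
  simp only [Prod.fst_swap, Prod.snd_swap, Nat.sub_self]
  abel

/-- The recursion bounds the partial sums by `S (m + 1) ≤ (1 + M / (m + δ)) * S m`. The factor tends
to `1`, so `S` grows more slowly than any geometric sequence of ratio `θ > 1`, and no radius is
lost. -/
theorem summable_norm_formal_solution {c r ρ M : ℝ} {a : ℕ → E →L[ℂ] E} {b u : ℕ → E}
    (hc : ‖a 0‖ < c) (hu : ∀ m : ℕ,
      ((m + c : ℝ) : ℂ) • u m = ∑ p ∈ Finset.HasAntidiagonal.antidiagonal m, a p.1 (u p.2) + b m)
    (hρ : 0 < ρ) (hρr : ρ < r) (ha : ∀ m, ‖a m‖ * r ^ m ≤ M)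
    (hb : ∀ m, ‖b m‖ * r ^ m ≤ M) : Summable fun m => ‖u m‖ * ρ ^ m := by
  have hr : 0 < r := hρ.trans hρr
  set δ := c - ‖a 0‖ with hδ
  have hδ0 : 0 < δ := sub_pos.2 hc
  -- The summand `1` absorbs the forcing term `b m`.
  set S : ℕ → ℝ := fun m => 1 + ∑ i ∈ Finset.range m, ‖u i‖ * r ^ i with hS
  have hS1 : ∀ m, 1 ≤ S m := fun m =>
    le_add_of_nonneg_right (Finset.sum_nonneg fun i _ => by positivity)
  have hSsucc : ∀ m, S (m + 1) = S m + ‖u m‖ * r ^ m := fun m => by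
    simp only [hS, Finset.sum_range_succ, add_assoc]
  have hterm : ∀ m : ℕ, (m + δ) * (‖u m‖ * r ^ m) ≤ M * S m := by
    intro m
    have h1 : ‖((m + c : ℝ) : ℂ) • u m‖ = (m + c) * ‖u m‖ := by
      rw [norm_smul, Complex.norm_real, Real.norm_of_nonneg]
      have := norm_nonneg (a 0)
      have := (Nat.cast_nonneg m : (0 : ℝ) ≤ m)
      linarith
    have h2 : ‖∑ p ∈ Finset.HasAntidiagonal.antidiagonal m, a p.1 (u p.2) + b m‖ ≤
        ∑ k ∈ Finset.range m, ‖a (m - k)‖ * ‖u k‖ + ‖a 0‖ * ‖u m‖ + ‖b m‖ := by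
      refine (norm_add_le _ _).trans (add_le_add_left ?_ _)
      refine (norm_sum_le _ _).trans ((Finset.sum_le_sum fun p _ =>
        (a p.1).le_opNorm (u p.2)).trans_eq ?_)
      rw [← Finset.Nat.sum_antidiagonal_swap,
        Finset.Nat.sum_antidiagonal_eq_sum_range_succ_mk, Finset.sum_range_succ]
      simp
    rw [← hu m, h1] at h2
    have h3 : (m + δ) * ‖u m‖ ≤ ∑ k ∈ Finset.range m, ‖a (m - k)‖ * ‖u k‖ + ‖b m‖ := by
      rw [hδ]; linarith
    calc (m + δ) * (‖u m‖ * r ^ m) = ((m + δ) * ‖u m‖) * r ^ m := by ring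
      _ ≤ (∑ k ∈ Finset.range m, ‖a (m - k)‖ * ‖u k‖ + ‖b m‖) * r ^ m := by gcongr
      _ = ∑ k ∈ Finset.range m, (‖a (m - k)‖ * r ^ (m - k)) * (‖u k‖ * r ^ k) +
          ‖b m‖ * r ^ m := by
        rw [add_mul, Finset.sum_mul]
        congr 1
        refine Finset.sum_congr rfl fun k hk => ?_
        rw [← Nat.sub_add_cancel (Finset.mem_range.1 hk).le, pow_add, Nat.add_sub_cancel]
        ring
      _ ≤ ∑ k ∈ Finset.range m, M * (‖u k‖ * r ^ k) + M := by
        gcongr with k _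
        · exact ha _
        · exact hb m
      _ = M * S m := by rw [← Finset.mul_sum, hS]; ring
  -- With `θ < r / ρ` the final comparison series has ratio `θ * ρ / r < 1`.
  obtain ⟨θ, hθ1, hθ2⟩ := exists_between ((one_lt_div hρ).2 hρr)
  have hθ0 : 0 < θ := zero_lt_one.trans hθ1
  obtain ⟨N, hN⟩ := exists_nat_ge (M / (θ - 1))
  have hstep : ∀ m, N ≤ m → S (m + 1) ≤ θ * S m := by
    intro m hm
    have hm' : (N : ℝ) ≤ m := by exact_mod_cast hm
    have h1 : M ≤ (m + δ) * (θ - 1) := by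
      rw [div_le_iff₀ (sub_pos.2 hθ1)] at hN
      refine hN.trans (mul_le_mul_of_nonneg_right ?_ (sub_pos.2 hθ1).le)
      linarith
    have h2 : (m + δ) * (‖u m‖ * r ^ m) ≤ (m + δ) * ((θ - 1) * S m) := by
      refine (hterm m).trans ?_
      rw [← mul_assoc]
      exact mul_le_mul_of_nonneg_right h1 (zero_le_one.trans (hS1 m))
    have h3 := le_of_mul_le_mul_left h2 (by positivity)
    rw [hSsucc]
    linarith
  have hSN : ∀ k, S (N + k) ≤ S N * θ ^ k := by
    intro k
    induction k with
    | zero => simp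
    | succ k ih =>
      calc S (N + (k + 1)) ≤ θ * S (N + k) := hstep _ (Nat.le_add_right _ _)
        _ ≤ θ * (S N * θ ^ k) := by gcongr
        _ = S N * θ ^ (k + 1) := by ring
  rw [← summable_nat_add_iff N]
  have hq : θ * ρ / r < 1 := by
    rw [div_lt_one hr]
    exact (lt_div_iff₀ hρ).1 hθ2
  refine Summable.of_nonneg_of_le (fun k => by positivity) (fun k => ?_)
    ((summable_geometric_of_lt_one (by positivity) hq).mul_left (S N * θ))
  have h1 : ‖u (k + N)‖ * r ^ (k + N) ≤ S N * θ ^ (k + 1) := by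
    refine le_trans ?_ (hSN (k + 1))
    rw [← add_assoc, hSsucc, add_comm N k]
    linarith [hS1 (k + N)]
  calc ‖u (k + N)‖ * ρ ^ (k + N)
      = (‖u (k + N)‖ * r ^ (k + N)) * ((ρ / r) ^ k * (ρ / r) ^ N) := by
        rw [← pow_add, div_pow]; field_simp
    _ ≤ (S N * θ ^ (k + 1)) * ((ρ / r) ^ k * 1) := by
        have : (ρ / r) ^ N ≤ 1 := pow_le_one₀ (by positivity) ((div_le_one hr).2 hρr.le)
        gcongr
    _ = S N * θ * (θ * ρ / r) ^ k := by
        rw [mul_div_assoc, mul_pow]; ring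

theorem exists_norm_mul_pow_le_of_summable {v : ℕ → E} {r : ℝ} (hr : 0 < r)
    (hs : Summable fun n => ((r : ℂ) ^ n) • v n) : ∃ M, ∀ n, ‖v n‖ * r ^ n ≤ M := by
  obtain ⟨M, hM⟩ := hs.tendsto_atTop_zero.norm.bddAbove_range
  refine ⟨M, fun n => ?_⟩
  have := hM ⟨n, rfl⟩
  simp only [norm_smul, norm_pow, Complex.norm_real, Real.norm_of_nonneg hr.le] at this
  linarith

open Metric in
/-- A linear differential equation with a singularity of the first kind at the origin has a
holomorphic solution, if its residue there is small compared with the shift `c`. -/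
theorem exists_solution_regular_singular [CompleteSpace E] {R : ENNReal} {c : ℝ}
    {C : ℂ → E →L[ℂ] E} {g : ℂ → E} (hC : DifferentiableOn ℂ C (eball 0 R))
    (hg : DifferentiableOn ℂ g (eball 0 R)) (hc : ‖C 0‖ < c) :
    ∃ G : ℂ → E, DifferentiableOn ℂ G (eball 0 R) ∧
      ∀ z ∈ eball 0 R, z • deriv G z + (c : ℂ) • G z = C z (G z) + g z := by
  set a : ℕ → E →L[ℂ] E := fun n => (n.factorial : ℂ)⁻¹ • iteratedDeriv n C 0 with ha
  set b : ℕ → E := fun n => (n.factorial : ℂ)⁻¹ • iteratedDeriv n g 0 with hb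
  have hCs : ∀ z ∈ eball (0 : ℂ) R, HasSum (fun n => z ^ n • a n) (C z) := by
    intro z hz
    refine (Complex.hasSum_taylorSeries_on_eball hC hz).congr_fun fun n => ?_
    rw [ha, sub_zero, smul_comm]
  have hgs : ∀ z ∈ eball (0 : ℂ) R, HasSum (fun n => z ^ n • b n) (g z) := by
    intro z hz
    refine (Complex.hasSum_taylorSeries_on_eball hg hz).congr_fun fun n => ?_
    rw [hb, sub_zero, smul_comm]
  have ha0 : ‖a 0‖ < c := by simpa [ha] using hc
  obtain ⟨u, hu⟩ := exists_formal_solution a b ha0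
  have hsum : ∀ z ∈ eball (0 : ℂ) R, ∃ ρ : ℝ, ‖z‖ < ρ ∧ ball 0 ρ ⊆ eball (0 : ℂ) R ∧
      (Summable fun n => ‖u n‖ * ρ ^ n) ∧ Summable fun n => ‖a n‖ * ρ ^ n := by
    intro z hz
    obtain ⟨r, hzr, hrR⟩ := exists_between (mem_eball.1 hz)
    lift r to NNReal using ne_top_of_lt hrR
    have hzr' : ‖z‖ < r := by
      rw [← mem_eball, eball_coe] at hzr
      exact mem_ball_zero_iff.1 hzr
    obtain ⟨ρ, hρ1, hρ2⟩ := exists_between hzr'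
    have hρ0 : 0 < ρ := (norm_nonneg z).trans_lt hρ1
    have hr0 : (0 : ℝ) < r := hρ0.trans hρ2
    have hrmem : ((r : ℝ) : ℂ) ∈ eball (0 : ℂ) R := by
      rw [mem_eball, edist_zero_right, enorm_eq_nnnorm]
      simpa using hrR
    obtain ⟨M₁, ha1⟩ := exists_norm_mul_pow_le_of_summable hr0 (hCs _ hrmem).summable
    obtain ⟨M₂, hb1⟩ := exists_norm_mul_pow_le_of_summable hr0 (hgs _ hrmem).summable
    refine ⟨ρ, hρ1, ?_, summable_norm_formal_solution ha0 hu hρ0 hρ2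
      (fun m => (ha1 m).trans (le_max_left M₁ M₂)) (fun m => (hb1 m).trans (le_max_right M₁ M₂)),
      summable_norm_mul_pow hρ0 hρ2 ha1⟩
    intro x hx
    rw [mem_ball_zero_iff] at hx
    refine mem_eball.2 (lt_of_le_of_lt (le_of_lt ?_) hrR)
    rw [← mem_eball, eball_coe]
    exact mem_ball_zero_iff.2 (hx.trans hρ2)
  have hdF : ∀ (n : ℕ) (z : ℂ), HasDerivAt (fun w : ℂ => w ^ n • u n) ((n * z ^ (n - 1)) • u n) z :=
    fun n z => (hasDerivAt_pow n z).smul_const (u n)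
  have hle : ∀ (ρ : ℝ) (n : ℕ), ∀ w ∈ ball (0 : ℂ) ρ, ‖w ^ n • u n‖ ≤ ‖u n‖ * ρ ^ n := by
    intro ρ n w hw
    rw [norm_smul, norm_pow, mul_comm]
    gcongr
    exact (mem_ball_zero_iff.1 hw).le
  refine ⟨fun z => ∑' n, z ^ n • u n, fun z hz => ?_, fun z hz => ?_⟩
  · obtain ⟨ρ, hzρ, hρR, hu1, -⟩ := hsum z hz
    have h1 := Complex.differentiableOn_tsum_of_summable_norm hu1
      (fun n w _ => (hdF n w).differentiableAt.differentiableWithinAt) isOpen_ball (hle ρ)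
    exact (h1.differentiableAt (isOpen_ball.mem_nhds (mem_ball_zero_iff.2 hzρ))).differentiableWithinAt
  · obtain ⟨ρ, hzρ, hρR, hu1, ha1⟩ := hsum z hz
    have hzb : z ∈ ball (0 : ℂ) ρ := mem_ball_zero_iff.2 hzρ
    have hus : Summable fun n => ‖z ^ n • u n‖ :=
      hu1.of_nonneg_of_le (fun _ => norm_nonneg _) fun n => hle ρ n z hzb
    have has : Summable fun n => ‖z ^ n • a n‖ := by
      refine ha1.of_nonneg_of_le (fun _ => norm_nonneg _) fun n => ?_
      rw [norm_smul, norm_pow, mul_comm]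
      gcongr
    have h1 := Complex.hasSum_deriv_of_summable_norm hu1
      (fun n w _ => (hdF n w).differentiableAt.differentiableWithinAt) isOpen_ball (hle ρ) hzb
    have h2 := (h1.const_smul z).add ((hus.of_norm.hasSum).const_smul (c : ℂ))
    have h3 := (hasSum_sum_antidiagonal_apply has hus).add (hgs z hz)
    rw [(hCs z hz).tsum_eq] at h3
    refine h2.unique (h3.congr_fun fun n => ?_)
    have h4 := congrArg (fun x => z ^ n • x) (hu n)
    simp only [smul_add, Finset.smul_sum] at h4
    have h5 : ∑ p ∈ Finset.HasAntidiagonal.antidiagonal n, (z ^ p.1 • a p.1) (z ^ p.2 • u p.2) =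
        ∑ p ∈ Finset.HasAntidiagonal.antidiagonal n, z ^ n • a p.1 (u p.2) := by
      refine Finset.sum_congr rfl fun p hp => ?_
      rw [← Finset.HasAntidiagonal.mem_antidiagonal.1 hp, pow_add]
      simp [smul_smul, mul_comm]
    rw [h5, ← h4, (hdF n z).deriv, smul_smul, smul_smul, smul_smul, ← add_smul]
    congr 1
    push_cast
    -- For `n = 0` the truncated exponent `n - 1` is harmless, because its factor `n` vanishes.
    rcases n with _ | n
    · simp
    · simp only [Nat.cast_add, Nat.cast_one, Nat.add_sub_cancel, pow_succ]
      ring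

end FormalSolution
-- Linear systems on discs and the gauge transformation
section LinearSystem

variable {𝔸 : Type*} [NormedRing 𝔸] [NormedAlgebra ℂ 𝔸] [CompleteSpace 𝔸]

-- A regular point is a singularity of the first kind with zero residue: for `y = v + (z - c) • G`
-- the equation becomes `z G' + G = z L G + L v` in the shifted variable, so the shift `1` suffices.
open Metric in
theorem exists_solution_linear_ode {E : Type*} [NormedAddCommGroup E] [NormedSpace ℂ E]
    [CompleteSpace E] {R : ENNReal} {L : ℂ → E →L[ℂ] E} {c : ℂ}
    (hL : DifferentiableOn ℂ L (eball c R)) (v : E) :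
    ∃ y : ℂ → E, y c = v ∧ ∀ z ∈ eball c R, HasDerivAt y (L z (y z)) z := by
  have hmap : Set.MapsTo (fun z => z + c) (eball 0 R) (eball c R) := by
    intro z hz
    simpa [mem_eball, edist_eq_enorm_sub] using hz
  have hL' : DifferentiableOn ℂ (fun z => L (z + c)) (eball 0 R) :=
    hL.comp (by fun_prop) hmap
  obtain ⟨G, hG, hGe⟩ := exists_solution_regular_singular (c := 1) (R := R)
    (C := fun z => z • L (z + c)) (g := fun z => L (z + c) v) (by fun_prop) (by fun_prop) (by simp)
  refine ⟨fun z => v + (z - c) • G (z - c), by simp, fun z hz => ?_⟩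
  have hz' : z - c ∈ eball (0 : ℂ) R := by
    simpa [mem_eball, edist_eq_enorm_sub] using hz
  have h1 : HasDerivAt (fun z => z - c) 1 z := (hasDerivAt_id z).sub_const c
  have h2 : HasDerivAt G (deriv G (z - c)) (z - c) :=
    (hG.differentiableAt (isOpen_eball.mem_nhds hz')).hasDerivAt
  have h3 := (h1.smul (h2.scomp z h1)).const_add v
  refine h3.congr_deriv ?_
  have h4 := hGe _ hz'
  simp only [Complex.ofReal_one, one_smul, sub_add_cancel, FunLike.coe_smul,
    Pi.smul_apply] at h4
  simp only [Function.comp, one_smul, map_add, map_smul]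
  rw [h4, add_comm]

open Metric in
/-- On a disc, a linear system with holomorphic coefficients has a fundamental solution `Φ`, with
inverse `Ψ`. -/
theorem exists_fundamental_solution [IsDedekindFiniteMonoid 𝔸] {R : ENNReal} {A : ℂ → 𝔸} {c : ℂ}
    (hR : 0 < R) (hA : DifferentiableOn ℂ A (eball c R)) :
    ∃ Φ Ψ : ℂ → 𝔸, Φ c = 1 ∧ Ψ c = 1 ∧ (∀ z ∈ eball c R, HasDerivAt Φ (A z * Φ z) z) ∧
      (∀ z ∈ eball c R, HasDerivAt Ψ (-(Ψ z * A z)) z) ∧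
      (∀ z ∈ eball c R, Φ z * Ψ z = 1) ∧ ∀ z ∈ eball c R, Ψ z * Φ z = 1 := by
  obtain ⟨Φ, hΦc, hΦ⟩ := exists_solution_linear_ode (E := 𝔸)
    (L := fun z => ContinuousLinearMap.mul ℂ 𝔸 (A z))
    ((ContinuousLinearMap.mul ℂ 𝔸).differentiable.comp_differentiableOn hA) 1
  obtain ⟨Ψ, hΨc, hΨ⟩ := exists_solution_linear_ode (E := 𝔸)
    (L := fun z => -(ContinuousLinearMap.mul ℂ 𝔸).flip (A z))
    (((ContinuousLinearMap.mul ℂ 𝔸).flip.differentiable.comp_differentiableOn hA).neg) 1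
  have hΦ' : ∀ z ∈ eball c R, HasDerivAt Φ (A z * Φ z) z := hΦ
  have hΨ' : ∀ z ∈ eball c R, HasDerivAt Ψ (-(Ψ z * A z)) z := hΨ
  -- Only the product in this order has visibly zero derivative; the other inverse relation comes
  -- from Dedekind finiteness.
  have hd : ∀ z ∈ eball c R, HasDerivAt (fun z => Ψ z * Φ z) 0 z := fun z hz => by
    refine ((hΨ' z hz).fun_mul (hΦ' z hz)).congr_deriv ?_
    noncomm_ring
  have hc : c ∈ eball c R := mem_eball_self hR
  have hone : ∀ z ∈ eball c R, Ψ z * Φ z = 1 := by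
    intro z hz
    have := isOpen_eball.is_const_of_deriv_eq_zero (convex_eball c R).isPreconnected
      (fun z hz => (hd z hz).differentiableAt.differentiableWithinAt)
      (fun z hz => (hd z hz).deriv) hz hc
    simpa [hΦc, hΨc] using this
  exact ⟨Φ, Ψ, hΦc, hΨc, hΦ', hΨ', fun z hz => mul_eq_one_symm (hone z hz), hone⟩

open Metric in
/-- On a disc on which the system `y' = A y` has holomorphic coefficients, its solutions are
obtained from their value at the center by an invertible transition function. -/
theorem exists_transition_function [IsDedekindFiniteMonoid 𝔸] {r : ℝ} {A : ℂ → 𝔸} {c : ℂ}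
    (hr : 0 < r) (hA : DifferentiableOn ℂ A (ball c r)) :
    ∃ Φ : ℂ → 𝔸, (∀ z ∈ ball c r, IsUnit (Φ z)) ∧ ∀ y : ℂ → 𝔸,
      (∀ z ∈ ball c r, HasDerivAt y (A z * y z) z) → ∀ z ∈ ball c r, y z = Φ z * y c := by
  rw [← eball_ofReal] at *
  have hR : 0 < ENNReal.ofReal r := ENNReal.ofReal_pos.2 hr
  obtain ⟨Φ, Ψ, -, hΨc, hΦ, hΨ, hΦΨ, hΨΦ⟩ := exists_fundamental_solution hR hA
  refine ⟨Φ, fun z hz => ⟨⟨Φ z, Ψ z, hΦΨ z hz, hΨΦ z hz⟩, rfl⟩, fun y hy z hz => ?_⟩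
  have hd : ∀ z ∈ eball c (ENNReal.ofReal r), HasDerivAt (fun z => Ψ z * y z) 0 z := by
    intro z hz
    refine ((hΨ z hz).fun_mul (hy z hz)).congr_deriv ?_
    noncomm_ring
  have := isOpen_eball.is_const_of_deriv_eq_zero (convex_eball c _).isPreconnected
      (fun z hz => (hd z hz).differentiableAt.differentiableWithinAt)
      (fun z hz => (hd z hz).deriv) hz (mem_eball_self hR)
  simp only [hΨc, one_mul] at this
  rw [← this, ← mul_assoc, hΦΨ z hz, one_mul]

-- If `Φ`, `Φ'` are fundamental solutions for `A`, `B`, then `Φ⁻¹ H Φ'` is constant, so `H z` and `H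
-- c` differ by invertible factors.
open Metric in
theorem isUnit_gauge_iff [IsDedekindFiniteMonoid 𝔸] {r : ℝ} {A B H : ℂ → 𝔸} {c : ℂ}
    (hA : DifferentiableOn ℂ A (ball c r)) (hB : DifferentiableOn ℂ B (ball c r))
    (hH : ∀ z ∈ ball c r, HasDerivAt H (A z * H z - H z * B z) z) {z : ℂ} (hz : z ∈ ball c r) :
    IsUnit (H z) ↔ IsUnit (H c) := by
  have hr : 0 < r := pos_of_mem_ball hz
  rw [← eball_ofReal] at *
  have hR : 0 < ENNReal.ofReal r := ENNReal.ofReal_pos.2 hr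
  obtain ⟨Φ, Ψ, -, hΨc, hΦ, hΨ, hΦΨ, hΨΦ⟩ := exists_fundamental_solution hR hA
  obtain ⟨Φ', Ψ', hΦc', -, hΦ', hΨ', hΦΨ', hΨΦ'⟩ := exists_fundamental_solution hR hB
  have hd : ∀ z ∈ eball c (ENNReal.ofReal r), HasDerivAt (fun z => Ψ z * H z * Φ' z) 0 z := by
    intro z hz
    refine (((hΨ z hz).fun_mul (hH z hz)).fun_mul (hΦ' z hz)).congr_deriv ?_
    noncomm_ring
  have := isOpen_eball.is_const_of_deriv_eq_zero (convex_eball c _).isPreconnected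
      (fun z hz => (hd z hz).differentiableAt.differentiableWithinAt)
      (fun z hz => (hd z hz).deriv) hz (mem_eball_self hR)
  simp only [hΨc, hΦc', one_mul, mul_one] at this
  rw [← this]
  let u : 𝔸ˣ := ⟨Ψ z, Φ z, hΨΦ z hz, hΦΨ z hz⟩
  let v : 𝔸ˣ := ⟨Φ' z, Ψ' z, hΦΨ' z hz, hΨΦ' z hz⟩
  change _ ↔ IsUnit (↑u * H z * ↑v)
  rw [Units.isUnit_mul_units, Units.isUnit_units_mul]

open Topology in
/-- Taylor expansion with remainder, for a holomorphic function on a neighborhood of `c`. -/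
theorem exists_taylor_remainder {E : Type*} [NormedAddCommGroup E] [NormedSpace ℂ E]
    [CompleteSpace E] {U : Set ℂ} {c : ℂ} (hU : U ∈ 𝓝 c) {f : ℂ → E}
    (hf : DifferentiableOn ℂ f U) (N : ℕ) : ∃ b S : ℂ → E, Differentiable ℂ b ∧
      DifferentiableOn ℂ S U ∧ ∀ x, f x = b x + (x - c) ^ N • S x := by
  induction N with
  | zero => exact ⟨0, f, differentiable_const 0, hf, fun x => by simp⟩
  | succ N ih =>
    obtain ⟨b, S, hb, hS, h⟩ := ih
    refine ⟨fun x => b x + (x - c) ^ N • S c, dslope S c, by fun_prop,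
      (Complex.differentiableOn_dslope hU).2 hS, fun x => ?_⟩
    rw [h x, pow_succ, mul_smul, sub_smul_dslope]
    module

open Metric Set Topology in
/-- A linear system on a simply connected domain, with a singularity of the first kind at `t`, is
holomorphically gauge equivalent to one whose regular part is entire. -/
theorem exists_gauge_to_entire {V : Set ℂ} (hVo : IsOpen V)
    (hVs : IsSimplyConnected V) {t : ℂ} (ht : t ∈ V) (q : 𝔸) {f : ℂ → 𝔸}
    (hf : DifferentiableOn ℂ f V) :
    ∃ b H : ℂ → 𝔸, Differentiable ℂ b ∧ DifferentiableOn ℂ H V ∧ H t = 1 ∧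
      ∀ x ∈ V, x ≠ t → HasDerivAt H
        (((x - t)⁻¹ • q + f x) * H x - H x * ((x - t)⁻¹ • q + b x)) x := by
  -- The commutator with `q` has norm at most `2 * ‖q‖`, so the shift `N` rules out resonance.
  obtain ⟨N, hN⟩ := exists_nat_gt (2 * ‖q‖)
  have hN0 : N ≠ 0 := by
    rintro rfl
    have := norm_nonneg q
    norm_num at hN
    linarith
  obtain ⟨b, S, hb, hS, hbS⟩ := exists_taylor_remainder (hVo.mem_nhds ht) hf N
  obtain ⟨R, φ, ψ, hR, hφt, hφ, hφm, hψ, hψm, hψφ, hφψ⟩ := exists_biholomorphic_eball hVo hVs ht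
  have h0 : (0 : ℂ) ∈ eball (0 : ℂ) R := mem_eball_self hR
  have hψ0 : ψ 0 = t := by rw [← hφt]; exact hψφ ht
  have hφd : ∀ x ∈ V, HasDerivAt φ (deriv φ x) x := fun x hx =>
    (hφ.differentiableAt (hVo.mem_nhds hx)).hasDerivAt
  have hψd : ∀ z ∈ eball (0 : ℂ) R, HasDerivAt ψ (deriv ψ z) z := fun z hz =>
    (hψ.differentiableAt (isOpen_eball.mem_nhds hz)).hasDerivAt
  have hinv : ∀ x ∈ V, deriv ψ (φ x) * deriv φ x = 1 := by
    intro x hx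
    have h1 := (hψd _ (hφm hx)).comp x (hφd x hx)
    refine h1.unique ((hasDerivAt_id x).congr_of_eventuallyEq ?_)
    exact Filter.mem_of_superset (hVo.mem_nhds hx) hψφ
  -- `ψ z - t = z * u z` with `u` zero-free, so the pole at `t` pulls back to a simple pole at `0`.
  set u : ℂ → ℂ := dslope ψ 0 with hu
  have huψ : ∀ z, z * u z = ψ z - t := by
    intro z
    have := sub_smul_dslope ψ 0 z
    rwa [sub_zero, smul_eq_mul, hψ0] at this
  have hud : DifferentiableOn ℂ u (eball 0 R) :=
    (Complex.differentiableOn_dslope (isOpen_eball.mem_nhds h0)).2 hψ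
  have hu0 : ∀ z ∈ eball (0 : ℂ) R, u z ≠ 0 := by
    intro z hz h
    by_cases hz0 : z = 0
    · have h1 := hinv t ht
      rw [hφt, ← dslope_same ψ 0, ← hu, ← hz0, h, zero_mul] at h1
      exact zero_ne_one h1
    · have h1 := huψ z
      rw [h, mul_zero, eq_comm, sub_eq_zero, ← hψ0] at h1
      exact hz0 (hφψ.injOn hz h0 h1)
  have hψ' : DifferentiableOn ℂ (deriv ψ) (eball 0 R) := hψ.deriv isOpen_eball
  -- `α` and `β` are the two coefficients pulled back along `ψ` and multiplied by `z`; both equal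
  -- `q` at `0`.
  set α : ℂ → 𝔸 := fun z => (deriv ψ z / u z) • q + (z * deriv ψ z) • f (ψ z) with hα
  set β : ℂ → 𝔸 := fun z => (deriv ψ z / u z) • q + (z * deriv ψ z) • b (ψ z) with hβ
  have hp : DifferentiableOn ℂ (fun z => deriv ψ z / u z) (eball 0 R) := hψ'.div hud hu0
  have hp0 : deriv ψ 0 / u 0 = 1 := by
    rw [hu, dslope_same, div_self]
    rw [← dslope_same ψ 0]
    exact hu0 0 h0
  have hα' : DifferentiableOn ℂ α (eball 0 R) :=
    (hp.smul_const q).add ((differentiableOn_id.mul hψ').smul (hf.comp hψ hψm))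
  have hβ' : DifferentiableOn ℂ β (eball 0 R) :=
    (hp.smul_const q).add ((differentiableOn_id.mul hψ').smul (hb.comp_differentiableOn hψ))
  have hα0 : α 0 = q := by simp [hα, hp0]
  have hβ0 : β 0 = q := by simp [hβ, hp0]
  -- Putting `K = 1 + z ^ N • G` into `z K' = α K - K β` gives `z G' + N G = α G - G β + z ^ (-N) (α
  -- - β)`. The last term is holomorphic since `α - β` contains `(ψ z - t) ^ N = z ^ N * u z ^ N`.
  obtain ⟨G, hG, hGe⟩ := exists_solution_regular_singular (R := R) (c := N)
    (C := fun z => ContinuousLinearMap.mul ℂ 𝔸 (α z) - (ContinuousLinearMap.mul ℂ 𝔸).flip (β z))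
    (g := fun z => (z * deriv ψ z * u z ^ N) • S (ψ z))
    (((ContinuousLinearMap.mul ℂ 𝔸).differentiable.comp_differentiableOn hα').sub
      ((ContinuousLinearMap.mul ℂ 𝔸).flip.differentiable.comp_differentiableOn hβ'))
    (((differentiableOn_id.mul hψ').mul (hud.pow N)).smul (hS.comp hψ hψm)) (by
      refine lt_of_le_of_lt (ContinuousLinearMap.opNorm_le_bound _ (by positivity) fun x => ?_) hN
      simp only [hα0, hβ0, sub_apply, ContinuousLinearMap.mul_apply',
        ContinuousLinearMap.flip_apply]
      refine (norm_sub_le _ _).trans ?_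
      linarith [norm_mul_le q x, norm_mul_le x q, mul_comm ‖q‖ ‖x‖])
  set K : ℂ → 𝔸 := fun z => 1 + z ^ N • G z with hK
  have hGd : ∀ z ∈ eball (0 : ℂ) R, HasDerivAt G (deriv G z) z := fun z hz =>
    (hG.differentiableAt (isOpen_eball.mem_nhds hz)).hasDerivAt
  have hKd : ∀ z ∈ eball (0 : ℂ) R, HasDerivAt K
      (z ^ N • deriv G z + (N * z ^ (N - 1)) • G z) z := fun z hz =>
    ((hasDerivAt_pow N z).fun_smul (hGd z hz)).const_add 1
  have hKe : ∀ z ∈ eball (0 : ℂ) R, z • deriv K z = α z * K z - K z * β z := by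
    intro z hz
    have h1 := hGe z hz
    simp only [sub_apply, ContinuousLinearMap.mul_apply',
        ContinuousLinearMap.flip_apply, Complex.ofReal_natCast] at h1
    have h2 : α z - β z = z ^ N • (z * deriv ψ z * u z ^ N) • S (ψ z) := by
      simp only [hα, hβ]
      rw [hbS (ψ z), ← huψ z, smul_add, smul_smul, smul_smul]
      module
    have h3 : z • deriv K z = z ^ N • (z • deriv G z + (N : ℂ) • G z) := by
      rw [(hKd z hz).deriv]
      obtain ⟨M, rfl⟩ := Nat.exists_eq_succ_of_ne_zero hN0
      simp only [Nat.succ_eq_add_one, Nat.add_sub_cancel, smul_add, smul_smul]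
      congr 2 <;> ring
    rw [h3, h1, smul_add, ← h2, hK]
    simp only [mul_add, add_mul, mul_one, one_mul, smul_sub, mul_smul_comm, smul_mul_assoc]
    abel
  refine ⟨b, K ∘ φ, hb, ?_, by simp [hK, hφt, hN0], fun x hx hxt => ?_⟩
  · exact DifferentiableOn.comp (t := eball 0 R)
      (fun z hz => (hKd z hz).differentiableAt.differentiableWithinAt) hφ hφm
  · have hz := hφm hx
    have hz0 : φ x ≠ 0 := fun h => hxt (by rw [← hψφ hx, h, hψ0])
    have h1 := (hKd _ hz).scomp x (hφd x hx)
    rw [← (hKd _ hz).deriv] at h1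
    refine h1.congr_deriv ?_
    have h2 := hKe _ hz
    have h3 : deriv ψ (φ x) / u (φ x) = φ x * deriv ψ (φ x) * (x - t)⁻¹ := by
      have h4 := huψ (φ x)
      rw [hψφ hx] at h4
      rw [← h4]
      have := hu0 _ hz
      field_simp
    have h4 : φ x * deriv ψ (φ x) ≠ 0 := mul_ne_zero hz0 (left_ne_zero_of_mul_eq_one (hinv x hx))
    have h5 : deriv φ x = φ x * (φ x * deriv ψ (φ x))⁻¹ := by
      have := left_ne_zero_of_mul_eq_one (hinv x hx)
      field_simp
      rw [mul_comm]; exact hinv x hx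
    have hα1 : α (φ x) = (φ x * deriv ψ (φ x)) • ((x - t)⁻¹ • q + f x) := by
      simp only [hα, h3, hψφ hx, smul_add, smul_smul]
    have hβ1 : β (φ x) = (φ x * deriv ψ (φ x)) • ((x - t)⁻¹ • q + b x) := by
      simp only [hβ, h3, hψφ hx, smul_add, smul_smul]
    rw [hα1, hβ1, smul_mul_assoc, mul_smul_comm, ← smul_sub] at h2
    rw [h5, mul_comm, mul_smul, h2, smul_smul, inv_mul_cancel₀ h4, one_smul]
    rfl

end LinearSystem
-- Continuation along paths
namespace UnivCover

open Topology in
/-- A property of the points of a universal covering space which holds at the base point, and which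
locally does not depend on the point, holds everywhere. -/
theorem forall_of_locally_iff {X : Type*} [TopologicalSpace X] {x₀ : X} {S : UnivCover x₀ → Prop}
    (h₀ : S ⟨x₀, Path.Homotopic.Quotient.refl x₀⟩)
    (hS : ∀ ξ : UnivCover x₀, ∃ W ∈ 𝓝 ξ.1, ∀ (y : X) (β : Path ξ.1 y), (∀ s, β s ∈ W) →
      (S ⟨y, ξ.2.trans (Path.Homotopic.Quotient.mk β)⟩ ↔ S ξ)) (ξ : UnivCover x₀) : S ξ := by
  obtain ⟨x, γ⟩ := ξ
  induction γ using Path.Homotopic.Quotient.ind with | mk γ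
  obtain ⟨f, rfl, rfl⟩ := γ
  set γ : Path (f 0) (f 1) := ⟨f, rfl, rfl⟩ with hγ
  -- `Ξ` lifts `γ` to the cover by its initial segments; along it the truth value is locally
  -- constant, hence constant on the interval.
  let Ξ : unitInterval → UnivCover (f 0) := fun s =>
    ⟨γ s, Path.Homotopic.Quotient.mk (γ.subpath 0 s)⟩
  have hΞ : ∀ s s' : unitInterval, Ξ s' =
      ⟨γ s', (Ξ s).2.trans (Path.Homotopic.Quotient.mk (γ.subpath s s'))⟩ := fun s s' =>
    congrArg (Sigma.mk (γ s')) (Path.Homotopic.Quotient.eq.2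
      ⟨Path.Homotopy.subpathTransSubpath γ 0 s s'⟩).symm
  have hlc : IsLocallyConstant fun s => S (Ξ s) := by
    rw [IsLocallyConstant.iff_eventually_eq]
    intro s
    obtain ⟨W, hW, hWS⟩ := hS (Ξ s)
    have hpre : (γ ⁻¹' W) ∈ 𝓝 s := γ.continuous.continuousAt hW
    obtain ⟨a, b, hab, hmem, hsub⟩ := exists_Icc_mem_subset_of_mem_nhds hpre
    filter_upwards [hmem] with s' hs'
    refine propext ?_
    rw [hΞ s s']
    refine hWS (γ s') _ fun r => ?_
    have h1 : γ.subpath s s' r ∈ γ '' Set.uIcc s s' := by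
      rw [← Path.range_subpath]
      exact ⟨r, rfl⟩
    obtain ⟨v, hv, hvr⟩ := h1
    rw [← hvr]
    exact hsub (Set.uIcc_subset_Icc hab hs' hv)
  have h1 : S (Ξ 0) := by
    have : Ξ 0 = ⟨f 0, Path.Homotopic.Quotient.refl (f 0)⟩ :=
      congrArg (fun p => (⟨f 0, Path.Homotopic.Quotient.mk p⟩ : UnivCover (f 0)))
        (γ.subpath_self 0)
    rwa [this]
  have h2 : S (Ξ 1) := by
    have := hlc.apply_eq_of_preconnectedSpace 0 1
    exact this.mp h1
  have h3 : Ξ 1 = ⟨f 1, Path.Homotopic.Quotient.mk γ⟩ :=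
    congrArg (fun p => (⟨f 1, Path.Homotopic.Quotient.mk p⟩ : UnivCover (f 0)))
      γ.subpath_zero_one
  exact (congrArg S h3).mp h2

end UnivCover

theorem Path.Homotopic.Quotient.map_trans_eq {X Y : Type*} [TopologicalSpace X]
    [TopologicalSpace Y] {x y z : X} (γ : Path.Homotopic.Quotient x y)
    (γ' : Path.Homotopic.Quotient y z) (f : C(X, Y)) :
    (γ.trans γ').map f = (γ.map f).trans (γ'.map f) := by
  induction γ using Path.Homotopic.Quotient.ind with | mk γ
  induction γ' using Path.Homotopic.Quotient.ind with | mk γ'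
  exact congrArg Path.Homotopic.Quotient.mk (Path.map_trans γ γ' f.continuous)

/-! ### The model system on the cover of the punctured plane -/

section PuncturedPlane

variable {𝔸 : Type*} [NormedRing 𝔸] [NormedAlgebra ℂ 𝔸] [CompleteSpace 𝔸]

/-- The translation of the punctured plane which moves the puncture to the origin. -/
def subPuncture (c : ℂ) : C(({c}ᶜ : Set ℂ), {z : ℂ // z ≠ 0}) where
  toFun x := ⟨x - c, sub_ne_zero.2 x.2⟩
  continuous_toFun := by fun_prop

open Metric in
/-- On the universal covering surface of a punctured plane, the system
`y' = (q / (x - c) + b) y` with entire `b` has a solution with prescribed initial value. -/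
theorem exists_solution_puncturedPlane [IsDedekindFiniteMonoid 𝔸] {c : ℂ} (p : ({c}ᶜ : Set ℂ))
    (q v : 𝔸) (hv : IsUnit v) {b : ℂ → 𝔸} (hb : Differentiable ℂ b) :
    ∃ P : UnivCover p → 𝔸, P ⟨p, Path.Homotopic.Quotient.refl p⟩ = v ∧ (∀ ξ, IsUnit (P ξ)) ∧
      ∀ ξ, ∃ (W : Set ℂ) (g : ℂ → 𝔸), UnivCover.IsSheet P ξ W g ∧
        ∀ x ∈ W, HasDerivAt g (((x - c)⁻¹ • q + b x) * g x) x := by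
  -- Under `x = c + exp s` the system becomes `dy/ds = D y`, which has no singularity.
  set D : ℂ → 𝔸 := fun s => q + Complex.exp s • b (c + Complex.exp s) with hD
  have hDd : Differentiable ℂ D := by
    have h1 : Differentiable ℂ fun s : ℂ => c + Complex.exp s := by fun_prop
    have h2 : Differentiable ℂ fun s => b (c + Complex.exp s) := hb.comp h1
    fun_prop
  obtain ⟨Φ, Ψ, -, -, hΦ, -, hΦΨ, hΨΦ⟩ := exists_fundamental_solution (R := ⊤) (c := 0)
    ENNReal.zero_lt_top (hDd.differentiableOn)
  simp only [eball_top, Set.mem_univ, forall_true_left] at hΦ hΦΨ hΨΦ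
  have hΦu : ∀ s, IsUnit (Φ s) := fun s => ⟨⟨Φ s, Ψ s, hΦΨ s, hΨΦ s⟩, rfl⟩
  have hΨu : ∀ s, IsUnit (Ψ s) := fun s => ⟨⟨Ψ s, Φ s, hΨΦ s, hΦΨ s⟩, rfl⟩
  have hcov := Complex.isCoveringMap_exp
  set s₀ : (fun z : ℂ ↦ (⟨_, z.exp_ne_zero⟩ : {z : ℂ // z ≠ 0})) ⁻¹' {subPuncture c p} :=
    ⟨Complex.log (p - c), Subtype.ext (Complex.exp_log (sub_ne_zero.2 p.2))⟩ with hs₀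
  -- `ℓ` is the continued logarithm of `x - c`, obtained by lifting paths through `exp`; homotopy
  -- invariance of lifting makes it well defined on the cover.
  let ℓ : ∀ ξ : UnivCover p,
      (fun z : ℂ ↦ (⟨_, z.exp_ne_zero⟩ : {z : ℂ // z ≠ 0})) ⁻¹' {subPuncture c ξ.1} :=
    fun ξ => hcov.monodromy (ξ.2.map (subPuncture c)) s₀
  refine ⟨fun ξ => Φ (ℓ ξ).1 * (Ψ s₀.1 * v), ?_, fun ξ => (hΦu _).mul ((hΨu _).mul hv),
    fun ξ => ?_⟩
  · have : ℓ ⟨p, Path.Homotopic.Quotient.refl p⟩ = s₀ := by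
      change hcov.monodromy (Path.Homotopic.Quotient.refl _) s₀ = s₀
      rw [hcov.monodromy_refl]
      rfl
    refine (congrArg (fun s => Φ s.1 * (Ψ s₀.1 * v)) this).trans ?_
    rw [← mul_assoc, hΦΨ, one_mul]
  · have hξ : (ξ.1 : ℂ) - c ≠ 0 := sub_ne_zero.2 ξ.1.2
    have hexp : Complex.exp (ℓ ξ).1 = ξ.1 - c := congrArg Subtype.val (ℓ ξ).2
    set L : ℂ → ℂ := fun x => (ℓ ξ).1 + Complex.log ((x - c) / (ξ.1 - c)) with hL
    have hslit : ∀ x ∈ ball (ξ.1 : ℂ) ‖(ξ.1 : ℂ) - c‖, (x - c) / (ξ.1 - c) ∈ Complex.slitPlane := by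
      intro x hx
      have h1 : ‖(x - ξ.1) / ((ξ.1 : ℂ) - c)‖ < 1 := by
        rw [norm_div, div_lt_one (norm_pos_iff.2 hξ), ← dist_eq_norm]
        exact hx
      have h2 : (x - c) / (ξ.1 - c) = 1 + (x - ξ.1) / ((ξ.1 : ℂ) - c) := by
        field_simp
        ring
      rw [h2]
      exact Complex.mem_slitPlane_of_norm_lt_one h1
    have hne : ∀ x ∈ ball (ξ.1 : ℂ) ‖(ξ.1 : ℂ) - c‖, x - c ≠ 0 := by
      intro x hx h
      have := hslit x hx
      rw [h, zero_div] at this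
      exact Complex.zero_notMem_slitPlane this
    have hLexp : ∀ x ∈ ball (ξ.1 : ℂ) ‖(ξ.1 : ℂ) - c‖, Complex.exp (L x) = x - c := by
      intro x hx
      rw [hL, Complex.exp_add, hexp, Complex.exp_log (div_ne_zero (hne x hx) hξ)]
      field_simp
    have hLd : ∀ x ∈ ball (ξ.1 : ℂ) ‖(ξ.1 : ℂ) - c‖, HasDerivAt L (x - c)⁻¹ x := by
      intro x hx
      have h1 := ((((hasDerivAt_id x).sub_const c).div_const ((ξ.1 : ℂ) - c)).clog
        (hslit x hx)).const_add (ℓ ξ).1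
      refine h1.congr_deriv ?_
      have := hne x hx
      simp only [id]
      field_simp
    refine ⟨ball ξ.1 ‖(ξ.1 : ℂ) - c‖, fun x => Φ (L x) * (Ψ s₀.1 * v),
      ⟨isOpen_ball, mem_ball_self (norm_pos_iff.2 hξ), fun x hx h => hne x hx (sub_eq_zero.2 h),
        fun y β hβ => ?_⟩, fun x hx => ?_⟩
    · have hy : (y : ℂ) ∈ ball (ξ.1 : ℂ) ‖(ξ.1 : ℂ) - c‖ := by simpa using hβ 1
      -- The local branch `L` lifts `β` explicitly, so monodromy along `β` ends at `L y`.
      let Γ : Path (ℓ ξ).1 (L y) :=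
        { toFun := fun s => L (β s)
          continuous_toFun := continuous_iff_continuousAt.2 fun s =>
            ((hLd _ (hβ s)).continuousAt).comp (f := fun s => (β s : ℂ))
              (continuous_subtype_val.comp β.continuous).continuousAt
          source' := by simp [hL, div_self hξ]
          target' := by simp }
      have h1 : hcov.monodromy ((Path.Homotopic.Quotient.mk β).map (subPuncture c)) (ℓ ξ) =
          ⟨L y, Subtype.ext (hLexp y hy)⟩ := by
        refine hcov.monodromy_eq_of_map_eq (Path.Homotopic.Quotient.mk Γ) ?_
        refine congrArg Path.Homotopic.Quotient.mk ?_
        ext s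
        exact hLexp _ (hβ s)
      have h2 : ℓ ⟨y, ξ.2.trans (Path.Homotopic.Quotient.mk β)⟩ =
          ⟨L y, Subtype.ext (hLexp y hy)⟩ := by
        rw [← h1]
        change hcov.monodromy ((ξ.2.trans (Path.Homotopic.Quotient.mk β)).map _) s₀ = _
        rw [Path.Homotopic.Quotient.map_trans_eq]
        exact hcov.monodromy_trans_apply _ _ _
      simp only [h2]
    · refine (((hΦ (L x)).scomp x (hLd x hx)).mul_const (Ψ s₀.1 * v)).congr_deriv ?_
      have h1 : (x - c)⁻¹ • D (L x) = (x - c)⁻¹ • q + b x := by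
        rw [hD]
        simp only [hLexp x hx, smul_add, smul_smul, inv_mul_cancel₀ (hne x hx), one_smul,
          add_sub_cancel]
      have h2 : ((x - c)⁻¹ • (D (L x) * Φ (L x))) * (Ψ s₀.1 * v) =
          ((x - c)⁻¹ • D (L x)) * (Φ (L x) * (Ψ s₀.1 * v)) := by
        rw [smul_mul_assoc, smul_mul_assoc, mul_assoc]
      exact h2.trans (by rw [h1])

end PuncturedPlane
-- The Fuchsian system at infinity and invertibility of its solution
section Fuchsian

open scoped Matrix.Norms.Operator

theorem hasDerivAt_matrix_iff {k : ℕ} {f : ℂ → Matrix (Fin k) (Fin k) ℂ}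
    {f' : Matrix (Fin k) (Fin k) ℂ} {x : ℂ} :
    HasDerivAt f f' x ↔ ∀ a b, HasDerivAt (fun x => f x a b) (f' a b) x :=
  (hasDerivAt_pi (φ := f) (φ' := f')).trans (forall_congr' fun _ => hasDerivAt_pi)

theorem differentiableAt_matrix_iff {k : ℕ} {f : ℂ → Matrix (Fin k) (Fin k) ℂ} {x : ℂ} :
    DifferentiableAt ℂ f x ↔ ∀ a b, DifferentiableAt ℂ (fun x => f x a b) x :=
  (differentiableAt_pi (Φ := f)).trans (forall_congr' fun _ => differentiableAt_pi)

variable {k n : ℕ} {t : Fin n → ℂ} {Q : Fin n → Matrix (Fin k) (Fin k) ℂ}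

theorem differentiableOn_fuchsianCoeff {U : Set ℂ} (hU : ∀ x ∈ U, ∀ j, x ≠ t j) :
    DifferentiableOn ℂ (fuchsianCoeff t Q) U := by
  unfold fuchsianCoeff
  refine DifferentiableOn.fun_sum fun j _ => DifferentiableOn.smul_const ?_ (Q j)
  exact (differentiableOn_id.sub_const _).inv fun x hx => sub_ne_zero.2 (hU x hx j)

/-- The coefficient of the Fuchsian system in the coordinate `w = 1 / x`. -/
noncomputable def fuchsianCoeffInfty (t : Fin n → ℂ) (Q : Fin n → Matrix (Fin k) (Fin k) ℂ)
    (w : ℂ) : Matrix (Fin k) (Fin k) ℂ :=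
  -∑ j, (t j * (1 - w * t j)⁻¹) • Q j

theorem differentiableOn_fuchsianCoeffInfty {U : Set ℂ} (hU : ∀ w ∈ U, ∀ j, 1 - w * t j ≠ 0) :
    DifferentiableOn ℂ (fuchsianCoeffInfty t Q) U := by
  unfold fuchsianCoeffInfty
  refine (DifferentiableOn.fun_sum fun j _ => DifferentiableOn.smul_const ?_ (Q j)).neg
  exact (((differentiableOn_id.mul_const _).const_sub 1).inv fun w hw => hU w hw j).const_mul _

/-- The change of coordinate produces a polar part `-w⁻¹ • ∑ j, Q j`, which the residue condition
removes. -/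
theorem fuchsianCoeffInfty_eq (hQ : ∑ j, Q j = 0) {w : ℂ} (hw : w ≠ 0)
    (hwt : ∀ j, 1 - w * t j ≠ 0) :
    fuchsianCoeffInfty t Q w = (-(w ^ 2)⁻¹) • fuchsianCoeff t Q w⁻¹ := by
  have h1 : fuchsianCoeffInfty t Q w = -(w⁻¹ • ∑ j, Q j) - ∑ j, (t j * (1 - w * t j)⁻¹) • Q j := by
    rw [hQ, smul_zero, neg_zero, zero_sub, fuchsianCoeffInfty]
  rw [h1, fuchsianCoeff, Finset.smul_sum, Finset.smul_sum, ← Finset.sum_neg_distrib,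
    ← Finset.sum_sub_distrib]
  refine Finset.sum_congr rfl fun j _ => ?_
  rw [smul_smul, ← neg_smul, ← sub_smul]
  congr 1
  have h2 := hwt j
  have h3 : w⁻¹ - t j = (1 - w * t j) / w := by field_simp
  rw [h3]
  field_simp
  ring

open Metric Filter Topology in
/-- Near infinity, a solution of the Fuchsian system satisfies a linear system with holomorphic
coefficients in the coordinate `w = 1 / x`. -/
theorem hasDerivAt_comp_coordInfty (hQ : ∑ j, Q j = 0)
    {g : OnePoint ℂ → Matrix (Fin k) (Fin k) ℂ} {ε : ℝ}
    (hεt : ∀ w ∈ ball (0 : ℂ) ε, ∀ j, 1 - w * t j ≠ 0)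
    (hg : ∀ w ∈ ball (0 : ℂ) ε, w ≠ 0 → HasDerivAt (fun x : ℂ => g x)
      (fuchsianCoeff t Q w⁻¹ * g (w⁻¹ : ℂ)) w⁻¹)
    (hg0 : DifferentiableAt ℂ (fun w => g (coordInfty w)) 0) {w : ℂ} (hw : w ∈ ball (0 : ℂ) ε) :
    HasDerivAt (fun w => g (coordInfty w)) (fuchsianCoeffInfty t Q w * g (coordInfty w)) w := by
  have hne : ∀ w ∈ ball (0 : ℂ) ε, w ≠ 0 → HasDerivAt (fun w => g (coordInfty w))
      (fuchsianCoeffInfty t Q w * g (coordInfty w)) w := by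
    intro w hw hw0
    have h1 := (hg w hw hw0).scomp w (hasDerivAt_inv hw0)
    have h2 : (fun w => g (coordInfty w)) =ᶠ[𝓝 w] (fun x : ℂ => g x) ∘ fun w => w⁻¹ := by
      filter_upwards [isOpen_ne.mem_nhds hw0] with x hx
      simp [coordInfty, show x ≠ 0 from hx]
    refine (h1.congr_of_eventuallyEq h2).congr_deriv ?_
    rw [fuchsianCoeffInfty_eq hQ hw0 (hεt w hw), smul_mul_assoc, coordInfty, if_neg hw0]
  -- The system is given at finite points only; at `w = 0` it follows by continuity of both sides.
  by_cases hw0 : w = 0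
  · subst hw0
    have hball : ball (0 : ℂ) ε ∈ 𝓝 0 := isOpen_ball.mem_nhds hw
    set y := fun w => g (coordInfty w) with hy
    have hyd : DifferentiableOn ℂ y (ball 0 ε) := by
      intro x hx
      by_cases hx0 : x = 0
      · subst hx0
        exact hg0.differentiableWithinAt
      · exact (hne x hx hx0).differentiableAt.differentiableWithinAt
    have h1 : Tendsto (deriv y) (𝓝[≠] 0) (𝓝 (deriv y 0)) :=
      (((hyd.deriv isOpen_ball).differentiableAt hball).continuousAt.tendsto).mono_left
        nhdsWithin_le_nhds
    have h2 : Tendsto (fun w => fuchsianCoeffInfty t Q w * y w) (𝓝[≠] 0)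
        (𝓝 (fuchsianCoeffInfty t Q 0 * y 0)) :=
      ((((differentiableOn_fuchsianCoeffInfty hεt).differentiableAt hball).continuousAt.mul
        hg0.continuousAt).tendsto).mono_left nhdsWithin_le_nhds
    have h3 : deriv y =ᶠ[𝓝[≠] 0] fun w => fuchsianCoeffInfty t Q w * y w := by
      filter_upwards [nhdsWithin_le_nhds hball, self_mem_nhdsWithin] with x hx hx0
      exact (hne x hx hx0).deriv
    have h4 : deriv y 0 = fuchsianCoeffInfty t Q 0 * y 0 :=
      tendsto_nhds_unique (h1.congr' h3) h2
    exact h4 ▸ hg0.hasDerivAt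
  · exact hne w hw hw0

open Metric in
theorem exists_coordInfty_disc {W : Set (OnePoint ℂ)} (hW : IsOpen W) (hWi : OnePoint.infty ∈ W) :
    ∃ (ε : ℝ) (W' : Set (OnePoint ℂ)), 0 < ε ∧ IsOpen W' ∧ OnePoint.infty ∈ W' ∧
      (∀ w ∈ ball (0 : ℂ) ε, w ≠ 0 → ((w⁻¹ : ℂ) : OnePoint ℂ) ∈ W) ∧
      ∀ x ∈ W', ∃ w ∈ ball (0 : ℂ) ε, x = coordInfty w := by
  obtain ⟨-, hK⟩ := (OnePoint.isOpen_iff_of_mem hWi).1 hW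
  obtain ⟨M, hM0, hM⟩ := hK.isBounded.exists_pos_norm_le
  refine ⟨M⁻¹, (OnePoint.some '' closedBall (0 : ℂ) M)ᶜ, inv_pos.2 hM0,
    OnePoint.isOpen_compl_image_coe.2 ⟨isClosed_closedBall, isCompact_closedBall 0 M⟩, by simp,
    fun w hw hw0 => ?_, fun x hx => ?_⟩
  · by_contra h
    have h1 := hM _ h
    rw [mem_ball_zero_iff, lt_inv_comm₀ (norm_pos_iff.2 hw0) hM0, ← norm_inv] at hw
    exact absurd h1 (not_le.2 hw)
  · induction x using OnePoint.rec with
    | infty => exact ⟨0, mem_ball_self (inv_pos.2 hM0), by simp [coordInfty]⟩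
    | coe z =>
      have hz : M < ‖z‖ := by
        by_contra! h
        exact hx ⟨z, mem_closedBall_zero_iff.2 h, rfl⟩
      have hz0 : z ≠ 0 := norm_pos_iff.1 (hM0.trans hz)
      refine ⟨z⁻¹, ?_, by simp [coordInfty, hz0]⟩
      rw [mem_ball_zero_iff, norm_inv]
      exact inv_strictAnti₀ hM0 hz

namespace UnivCover

theorem IsSheet.apply_self {S E : Type*} [TopologicalSpace S] {U : Set S} {x₀ : U}
    {f : UnivCover x₀ → E} {ξ : UnivCover x₀} {W : Set S} {g : S → E} (h : IsSheet f ξ W g) :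
    f ξ = g ξ.1 := by
  have := h.2.2.2 ξ.1 (Path.refl _) fun _ => h.2.1
  rw [Path.Homotopic.Quotient.mk_refl, Path.Homotopic.Quotient.trans_refl] at this
  exact this

end UnivCover

-- On a small disc solutions are an invertible transition function times their central value, so
-- invertibility is locally constant on the cover. Around infinity this is applied in the coordinate
-- `w = 1 / x`.
open Metric Topology in
theorem IsNormalizedSolution.isUnit (hQ : ∑ j, Q j = 0)
    {Y : UnivCover (inftyPoint t) → Matrix (Fin k) (Fin k) ℂ} (hY : IsNormalizedSolution t Q Y)
    (ξ : UnivCover (inftyPoint t)) : IsUnit (Y ξ) := by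
  refine UnivCover.forall_of_locally_iff (S := fun ξ => IsUnit (Y ξ))
    (by simp only [hY.normalized, isUnit_one]) (fun ξ => ?_) ξ
  obtain ⟨W, g, hsheet, hhol, hode⟩ := hY.solves ξ
  have hself := hsheet.apply_self
  obtain ⟨hWo, hξW, hWU, hW⟩ := hsheet
  have hWt : ∀ z : ℂ, (z : OnePoint ℂ) ∈ W → ∀ j, z ≠ t j := fun z hz j h =>
    hWU hz j (congrArg _ h)
  rcases hx : (ξ.1 : OnePoint ℂ) with _ | z₀
  · have hξi : (ξ.1 : OnePoint ℂ) = OnePoint.infty := hx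
    rw [hξi] at hξW hself
    obtain ⟨ε, W', hε, hW'o, hW'i, hball, hW'⟩ := exists_coordInfty_disc hWo hξW
    have hεt : ∀ w ∈ ball (0 : ℂ) ε, ∀ j, 1 - w * t j ≠ 0 := by
      intro w hw j h
      have hw0 : w ≠ 0 := by
        rintro rfl
        simp at h
      refine hWt _ (hball w hw hw0) j ?_
      exact (eq_inv_of_mul_eq_one_right (sub_eq_zero.1 h).symm).symm
    have hderiv := fun w hw => hasDerivAt_comp_coordInfty hQ hεt
      (fun w hw hw0 => hasDerivAt_matrix_iff.2 (hode _ (hball w hw hw0)))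
      (differentiableAt_matrix_iff.2 (hhol.2 hξW)) (w := w) hw
    obtain ⟨Φ, hΦu, hΦ⟩ := exists_transition_function hε
      (differentiableOn_fuchsianCoeffInfty (Q := Q) hεt)
    have hc0 : coordInfty 0 = OnePoint.infty := if_pos rfl
    refine ⟨Subtype.val ⁻¹' (W ∩ W'), ((hWo.inter hW'o).preimage
      continuous_subtype_val).mem_nhds ?_, fun y β hβ => ?_⟩
    · rw [Set.mem_preimage, hξi]
      exact ⟨hξW, hW'i⟩
    · rw [hW y β fun s => (hβ s).1, hself]
      have hy : (y : OnePoint ℂ) ∈ W ∩ W' := by simpa using hβ 1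
      obtain ⟨w, hw, hyw⟩ := hW' y hy.2
      have h1 := hΦ _ hderiv w hw
      simp only [hc0] at h1
      obtain ⟨u, hu⟩ := hΦu w hw
      rw [hyw, h1, ← hu, Units.isUnit_units_mul]
  · have hξz : (ξ.1 : OnePoint ℂ) = (z₀ : OnePoint ℂ) := hx
    rw [hξz] at hξW hself
    obtain ⟨r, hr, hrW⟩ := Metric.isOpen_iff.1 (hWo.preimage OnePoint.continuous_coe) z₀ hξW
    obtain ⟨Φ, hΦu, hΦ⟩ := exists_transition_function hr
      (differentiableOn_fuchsianCoeff (Q := Q) fun z hz => hWt z (hrW hz))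
    have hderiv : ∀ z ∈ ball z₀ r, HasDerivAt (fun z : ℂ => g z) (fuchsianCoeff t Q z * g z) z :=
      fun z hz => hasDerivAt_matrix_iff.2 (hode z (hrW hz))
    refine ⟨Subtype.val ⁻¹' (OnePoint.some '' ball z₀ r),
      ((OnePoint.isOpenEmbedding_coe.isOpenMap _ isOpen_ball).preimage
      continuous_subtype_val).mem_nhds ?_, fun y β hβ => ?_⟩
    · rw [Set.mem_preimage, hξz]
      exact ⟨z₀, mem_ball_self hr, rfl⟩
    · rw [hW y β fun s => ?_, hself]
      · obtain ⟨z, hz, hzy⟩ : (y : OnePoint ℂ) ∈ OnePoint.some '' ball z₀ r := by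
          simpa using hβ 1
        obtain ⟨u, hu⟩ := hΦu z hz
        rw [← hzy, hΦ _ hderiv z hz, ← hu, Units.isUnit_units_mul]
      · obtain ⟨z, hz, hzy⟩ := hβ s
        rw [← hzy]
        exact hrW hz

-- The invertibility locus is open by continuity and relatively closed: around `x ≠ c` invertibility
-- is constant on a disc, and at `c` it is given. Connectedness does the rest.
open Metric Topology Set in
theorem isUnit_of_gauge {V : Set ℂ} (hVo : IsOpen V) (hVc : IsPreconnected V) {c : ℂ} (hc : c ∈ V)
    {A B H : ℂ → Matrix (Fin k) (Fin k) ℂ} (hA : DifferentiableOn ℂ A (V \ {c}))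
    (hB : DifferentiableOn ℂ B (V \ {c})) (hH : ContinuousOn H V) (hHc : IsUnit (H c))
    (hHd : ∀ x ∈ V, x ≠ c → HasDerivAt H (A x * H x - H x * B x) x) :
    ∀ x ∈ V, IsUnit (H x) := by
  have hopen : IsOpen (V ∩ H ⁻¹' {M | IsUnit M}) := hH.isOpen_inter_preimage hVo Units.isOpen
  have hsub : V ⊆ V ∩ H ⁻¹' {M | IsUnit M} := by
    refine hVc.subset_of_closure_inter_subset hopen ⟨c, hc, hc, hHc⟩ ?_
    rintro x ⟨hx, hxV⟩
    refine ⟨hxV, ?_⟩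
    by_cases hxc : x = c
    · exact hxc ▸ hHc
    · obtain ⟨r, hr, hrV⟩ := Metric.isOpen_iff.1 (hVo.sdiff (isClosed_singleton (x := c))) x
        ⟨hxV, hxc⟩
      obtain ⟨y, hy, hyV⟩ := mem_closure_iff.1 hx _ isOpen_ball (mem_ball_self hr)
      exact (isUnit_gauge_iff (hA.mono hrV) (hB.mono hrV)
        (fun z hz => hHd z (hrV hz).1 (hrV hz).2) hy).1 hyV.2
  exact fun x hx => (hsub hx).2

theorem fuchsianCoeff_eq_add (j : Fin n) (x : ℂ) : fuchsianCoeff t Q x =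
    (x - t j)⁻¹ • Q j + ∑ i ∈ Finset.univ.erase j, (x - t i)⁻¹ • Q i :=
  (Finset.add_sum_erase _ _ (Finset.mem_univ j)).symm

end Fuchsian

/-! ### The factorization -/

open scoped Matrix.Norms.Operator in
theorem theorem1p1 {k n : ℕ} (t : Fin n → ℂ) (ht : Function.Injective t)
    (Q : Fin n → Matrix (Fin k) (Fin k) ℂ) (hQ : ∑ j, Q j = 0)
    (Y : UnivCover (inftyPoint t) → Matrix (Fin k) (Fin k) ℂ)
    (hY : IsNormalizedSolution t Q Y)
    (j : Fin n) (V : Set ℂ) (hVo : IsOpen V) (hVs : IsSimplyConnected V) (htV : t j ∈ V)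
    (hV : ∀ i, i ≠ j → t i ∉ V)
    (p : (V \ {t j} : Set ℂ)) (α : Path (inftyPoint t) (inclSphere t j V hV p)) :
    ∃ (H : ℂ → Matrix (Fin k) (Fin k) ℂ)
      (P : UnivCover (inclPlane V (t j) p) → Matrix (Fin k) (Fin k) ℂ),
      ((∀ a b, DifferentiableOn ℂ (fun x => H x a b) V) ∧ ∀ x ∈ V, IsUnit (H x)) ∧
      (UnivCover.IsHolomorphic P ∧ ∀ ξ, IsUnit (P ξ)) ∧
      ∀ ξ : UnivCover p,
        branch Y hV α ξ = H (ξ.1 : ℂ) * P (UnivCover.map (inclPlane V (t j)) ξ) := by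
  have hVt : ∀ x ∈ V \ {t j}, ∀ i, x ≠ t i := by
    rintro x ⟨hx, hxj⟩ i rfl
    by_cases hij : i = j
    · exact hxj (hij ▸ rfl)
    · exact hV i hij hx
  have hreg : DifferentiableOn ℂ (fun x => ∑ i ∈ Finset.univ.erase j, (x - t i)⁻¹ • Q i) V := by
    refine DifferentiableOn.fun_sum fun i hi => DifferentiableOn.smul_const ?_ (Q i)
    refine (differentiableOn_id.sub_const _).inv fun x hx => sub_ne_zero.2 ?_
    rintro rfl
    exact hV i (Finset.ne_of_mem_erase hi) hx
  obtain ⟨b, H, hb, hH, hHt, hHd⟩ := exists_gauge_to_entire hVo hVs htV (Q j) hreg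
  have hHA : ∀ x ∈ V, x ≠ t j → HasDerivAt H
      (fuchsianCoeff t Q x * H x - H x * ((x - t j)⁻¹ • Q j + b x)) x := fun x hx hxt => by
    rw [fuchsianCoeff_eq_add j]
    exact hHd x hx hxt
  have hHu : ∀ x ∈ V, IsUnit (H x) := by
    refine isUnit_of_gauge hVo hVs.isPathConnected.isConnected.isPreconnected htV
      (differentiableOn_fuchsianCoeff hVt) ?_ hH.continuousOn (hHt ▸ isUnit_one) hHA
    refine DifferentiableOn.add (DifferentiableOn.smul_const ?_ _) hb.differentiableOn
    exact (differentiableOn_id.sub_const _).inv fun x hx => sub_ne_zero.2 hx.2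
  obtain ⟨u, hu⟩ := hHu p p.2.1
  set Y₀ := branch Y hV α ⟨p, Path.Homotopic.Quotient.refl p⟩ with hY₀
  -- The initial value `H(p)⁻¹ Y₀` makes both sides agree at the base point.
  obtain ⟨P, hPp, hPu, hPs⟩ := exists_solution_puncturedPlane (inclPlane V (t j) p) (Q j)
    ((↑u⁻¹ : Matrix (Fin k) (Fin k) ℂ) * Y₀) (u⁻¹.isUnit.mul (hY.isUnit hQ _)) hb
  refine ⟨H, P, ⟨fun a b x hx => ?_, hHu⟩, ⟨fun ξ => ?_, hPu⟩, fun ξ => ?_⟩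
  · exact (differentiableAt_matrix_iff.1 (hH.differentiableAt (hVo.mem_nhds hx)) a
      b).differentiableWithinAt
  · obtain ⟨W, g, hg, hgd⟩ := hPs ξ
    exact ⟨W, g, hg, fun a b x hx =>
      (differentiableAt_matrix_iff.1 (hgd x hx).differentiableAt a b).differentiableWithinAt⟩
  · refine UnivCover.forall_of_locally_iff (S := fun ξ : UnivCover p =>
      branch Y hV α ξ = H (ξ.1 : ℂ) * P (UnivCover.map (inclPlane V (t j)) ξ)) ?_ (fun ξ => ?_) ξ
    · have h1 : P (UnivCover.map (inclPlane V (t j)) ⟨p, Path.Homotopic.Quotient.refl p⟩) =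
          (↑u⁻¹ : Matrix (Fin k) (Fin k) ℂ) * Y₀ := hPp
      change Y₀ = H p * _
      rw [h1, ← hu, ← mul_assoc, Units.mul_inv, one_mul]
    · obtain ⟨W₁, g₁, hs₁, -, hode₁⟩ :=
        hY.solves (UnivCover.precomp α (UnivCover.map (inclSphere t j V hV) ξ))
      obtain ⟨W₂, g₂, hs₂, hode₂⟩ := hPs (UnivCover.map (inclPlane V (t j)) ξ)
      have hv₁ : branch Y hV α ξ = g₁ ((ξ.1 : ℂ) : OnePoint ℂ) := hs₁.apply_self
      have hv₂ : P (UnivCover.map (inclPlane V (t j)) ξ) = g₂ (ξ.1 : ℂ) := hs₂.apply_self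
      obtain ⟨ho₁, hm₁, -, hW₁⟩ := hs₁
      obtain ⟨ho₂, hm₂, -, hW₂⟩ := hs₂
      have hopen : IsOpen (((↑) : ℂ → OnePoint ℂ) ⁻¹' W₁ ∩ W₂ ∩ (V \ {t j})) :=
        ((ho₁.preimage OnePoint.continuous_coe).inter ho₂).inter (hVo.sdiff isClosed_singleton)
      obtain ⟨r, hr, hrW⟩ := Metric.isOpen_iff.1 hopen ξ.1 ⟨⟨hm₁, hm₂⟩, ξ.1.2⟩
      -- Near `ξ` both `Y` and `H P` are `Φ` times their values at `ξ`; as `Φ` is invertible, they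
      -- agree at a nearby point exactly when they agree at `ξ`.
      obtain ⟨Φ, hΦu, hΦ⟩ := exists_transition_function hr
        ((differentiableOn_fuchsianCoeff (Q := Q) hVt).mono fun z hz => (hrW hz).2)
      have hd₁ : ∀ z ∈ Metric.ball (ξ.1 : ℂ) r,
          HasDerivAt (fun z : ℂ => g₁ z) (fuchsianCoeff t Q z * g₁ z) z := fun z hz =>
        hasDerivAt_matrix_iff.2 (hode₁ z (hrW hz).1.1)
      have hd₂ : ∀ z ∈ Metric.ball (ξ.1 : ℂ) r,
          HasDerivAt (fun z : ℂ => H z * g₂ z) (fuchsianCoeff t Q z * (H z * g₂ z)) z := by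
        intro z hz
        refine ((hHA z (hrW hz).2.1 (hrW hz).2.2).fun_mul (hode₂ z (hrW hz).1.2)).congr_deriv ?_
        noncomm_ring
      refine ⟨Subtype.val ⁻¹' Metric.ball (ξ.1 : ℂ) r, (Metric.isOpen_ball.preimage
        continuous_subtype_val).mem_nhds (Metric.mem_ball_self hr), fun y β hβ => ?_⟩
      have hy : (y : ℂ) ∈ Metric.ball (ξ.1 : ℂ) r := β.target ▸ hβ 1
      have e₁ : branch Y hV α ⟨y, ξ.2.trans (Path.Homotopic.Quotient.mk β)⟩ =
          g₁ ((y : ℂ) : OnePoint ℂ) := by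
        refine Eq.trans (congrArg (fun γ => Y ⟨inclSphere t j V hV y, γ⟩) ?_)
          (hW₁ (inclSphere t j V hV y) (β.map (inclSphere t j V hV).continuous)
            fun s => (hrW (hβ s)).1.1)
        change (Path.Homotopic.Quotient.mk α).trans ((ξ.2.trans _).map _) = _
        rw [Path.Homotopic.Quotient.map_trans_eq, ← Path.Homotopic.Quotient.trans_assoc]
        rfl
      have e₂ : P (UnivCover.map (inclPlane V (t j))
          ⟨y, ξ.2.trans (Path.Homotopic.Quotient.mk β)⟩) = g₂ y := by
        refine Eq.trans (congrArg (fun γ => P ⟨inclPlane V (t j) y, γ⟩) ?_)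
          (hW₂ (inclPlane V (t j) y) (β.map (inclPlane V (t j)).continuous)
            fun s => (hrW (hβ s)).1.2)
        exact Path.Homotopic.Quotient.map_trans_eq _ _ _
      obtain ⟨v, hv⟩ := hΦu y hy
      rw [e₁, e₂, hv₁, hv₂, hΦ _ hd₁ y hy, hΦ _ hd₂ y hy, ← hv, Units.mul_right_inj]
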